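/- All graphs are finite directed graphs; a DAG is an acyclic one. A DAG $G$ is $(e,d)$-depth-robust if for every set $S$ of at most $e$ vertices, $G-S$ contains a directed path on at least $d$ vertices. A graph with $n$ inputs and $n$ outputs has $n$ designated distinct input vertices and $n$ designated distinct output vertices. A DAG with $n$ inputs and $n$ outputs is an $n$-superconcentrator if for every $r\le n$, any $r$ inputs and any $r$ outputs, there are $r$ vertex-disjoint directed paths connecting these inputs to these outputs (in some order). A graph $G$ with $n$ inputs and $n$ outputs is $(k_1,k_2)$-ST-robust if for every $D\subseteq V(G)$ with $|D|\le k_1$ there is a subgraph $H$ of $G-D$ that contains at least $k_2$ inputs and at least $k_2$ outputs such that $H$ contains a directed path from each input in $V(H)$ to each output in $V(H)$. Construction of $M_n$. Let $H_n$ be a graph on $n$ vertices and let $SC_n^1,SC_n^2$ be graphs with $n$ inputs and $n$ outputs. Let $G_n$ consist of three disjoint copies $H_n^1,H_n^2,H_n^3$ of $H_n$ in which, for $i\in\{1,2\}$ and each vertex $v$ of $H_n^{i+1}$, one samples $\tau$ vertices of $H_n^{i}$ independently and uniformly at random (all samples being independent) and adds an edge from each of them to $v$. The random graph $M_n$ is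 the disjoint union of $SC_n^1$, $G_n$ and $SC_n^2$, together with an edge from each output of $SC_n^1$ to a vertex of $H_n^1$ and an edge from each vertex of $H_n^3$ to an input of $SC_n^2$, both according to a bijection. The inputs of $M_n$ are those of $SC_n^1$, its outputs are those of $SC_n^2$. Theorem. (a) There are a constant $c>0$ and a family $(H_n)_{n\ge 1}$ of DAGs of constant indegree such that $H_n$ has $n$ vertices and is $(cn,n^{2/3})$-depth-robust. There is a family of $n$-superconcentrators ($n\ge 1$) of constant indegree with $O(n)$ vertices. (b) For every constant $c>0$ there are constants $c'>0$ and $\tau_0$, depending only on $c$, such that the following holds for every constant $\tau\ge\tau_0$. Let $(H_n)_{n\ge1}$ be any family of DAGs with indegree at most $\delta_H$ such that $H_n$ has $n$ vertices and is $(cn,n^{2/3})$-depth-robust, and let $(SC^1_n)_{n\ge1}$, $(SC^2_n)_{n\ge1}$ be any families of $n$-superconcentrators with at most $a n$ vertices and indegree at most $\delta_{SC}$ (with constants $\delta_H,\delta_{SC},a$). Then for every $n\ge1$ and every outcome of the sampling, $M_n$ is a DAG with $n$ inputs and $n$ outputs, with indegree at most $\delta_H+\delta_{SC}+\tau+1$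 and at most $(2a+3)n$ vertices; and for all sufficiently large $n$, with probability at least $1-2^{-n}$, the graph $M_n$ is $(|S|,n-|S|)$-ST-robust simultaneously for all sets $S\subseteq V(M_n)$ with $|S|\le c'n/2$. -/

import Mathlib

namespace STRobustness

/-- A directed graph is a DAG if no vertex can be reached from itself by a nonempty walk. -/
def IsDAG {V : Type} (G : Digraph V) : Prop :=
  ∀ v, ¬ Relation.TransGen G.Adj v v

/-- Every vertex has at most `d` in-neighbours. -/
def IndegreeLE {V : Type} (G : Digraph V) (d : ℕ) : Prop :=
  ∀ v, {u | G.Adj u v}.ncard ≤ d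

/-- A directed path, given by the nonempty list of its (distinct) vertices. -/
def IsPath {V : Type} (G : Digraph V) (p : List V) : Prop :=
  p ≠ [] ∧ p.IsChain G.Adj ∧ p.Nodup

/-- `p` is a directed path from `s` to `t`. -/
def IsPathFromTo {V : Type} (G : Digraph V) (s t : V) (p : List V) : Prop :=
  IsPath G p ∧ p.head? = some s ∧ p.getLast? = some t

/-- `(e, d)`-depth-robustness: after deleting any set `S` of at most `e` vertices there is still a
directed path with at least `d` vertices. -/
def DepthRobust {V : Type} (G : Digraph V) (e d : ℝ) : Prop :=
  ∀ S : Finset V, (S.card : ℝ) ≤ e → ∃ p : List V, IsPath G p ∧ (∀ v ∈ p, v ∉ S) ∧ d ≤ p.length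

/-- A finite directed graph with `n` designated (distinct) input vertices and `n` designated
(distinct) output vertices. -/
structure IODigraph (n : ℕ) where
  /-- the vertices -/
  V : Type
  /-- there are finitely many vertices -/
  [fintypeV : Fintype V]
  /-- the directed edges -/
  graph : Digraph V
  /-- the inputs -/
  input : Fin n ↪ V
  /-- the outputs -/
  output : Fin n ↪ V

attribute [instance] IODigraph.fintypeV

/-- `n`-superconcentrator: a DAG with `n` inputs and `n` outputs such that any `r` inputs `X` and
any `r` outputs `Y` are joined (in some order, given by the bijection `f`) by `r` vertex-disjoint
directed paths. -/
def IsSuperconcentrator {n : ℕ} (G : IODigraph n) : Prop :=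
  IsDAG G.graph ∧
  ∀ X Y : Finset (Fin n), X.card = Y.card →
    ∃ (f : Fin n → Fin n) (p : Fin n → List G.V),
      Set.BijOn f X Y ∧
      (∀ i ∈ X, IsPathFromTo G.graph (G.input i) (G.output (f i)) (p i)) ∧
      ∀ i ∈ X, ∀ j ∈ X, i ≠ j → List.Disjoint (p i) (p j)

/-- `(k₁, k₂)`-ST-robustness: for every set `D` of at most `k₁` vertices, `G - D` has a subgraph,
with vertex set `W` and edges `F`, that contains at least `k₂` inputs and at least `k₂` outputs, and
in which there is a path from every input in `W` to every output in `W`. -/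
def STRobust {n : ℕ} (G : IODigraph n) (k₁ k₂ : ℕ) : Prop :=
  ∀ D : Finset G.V, D.card ≤ k₁ →
    ∃ (W : Set G.V) (F : Digraph G.V),
      (∀ v ∈ W, v ∉ D) ∧
      (∀ u v, F.Adj u v → u ∈ W ∧ v ∈ W ∧ G.graph.Adj u v) ∧
      k₂ ≤ (Set.range G.input ∩ W).ncard ∧
      k₂ ≤ (Set.range G.output ∩ W).ncard ∧
      ∀ s ∈ Set.range G.input ∩ W, ∀ t ∈ Set.range G.output ∩ W,
        Relation.ReflTransGen F.Adj s t

/-- The outcomes of the random choices: for each of the two pairs of consecutive layers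
(`i = 0`: layers 1 and 2, `i = 1`: layers 2 and 3) and each vertex `v` of the upper layer,
`x i v 0, …, x i v (τ - 1)` are the sampled vertices of the lower layer. Independent uniform
sampling is the uniform distribution on this finite type. -/
abbrev Samples (n τ : ℕ) : Type := Fin 2 → Fin n → Fin τ → Fin n

/-- The edges of the three-layer graph `G_n`: three disjoint copies of `H`, and an edge from
`x i v t` (in layer `i`) to `v` (in layer `i + 1`) for each of the samples. -/
inductive ThreeLayerAdj {n τ : ℕ} (H : Digraph (Fin n)) (x : Samples n τ) :
    Fin 3 × Fin n → Fin 3 × Fin n → Prop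
  | layer (i : Fin 3) (u v : Fin n) : H.Adj u v → ThreeLayerAdj H x (i, u) (i, v)
  | sampled (i : Fin 2) (v : Fin n) (t : Fin τ) :
      ThreeLayerAdj H x (i.castSucc, x i v t) (i.succ, v)

/-- The graph `G_n` built from `H` and the samples `x`. -/
def threeLayer {n τ : ℕ} (H : Digraph (Fin n)) (x : Samples n τ) : Digraph (Fin 3 × Fin n) :=
  ⟨ThreeLayerAdj H x⟩

/-- The edges of the sandwich: those of `A`, of the three-layer graph and of `B`, an edge from the
`j`-th output of `A` to vertex `j` of the first layer, and an edge from vertex `j` of the last layer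
to the `j`-th input of `B`. -/
inductive SandwichAdj {n τ : ℕ} (H : Digraph (Fin n)) (A B : IODigraph n) (x : Samples n τ) :
    A.V ⊕ (Fin 3 × Fin n) ⊕ B.V → A.V ⊕ (Fin 3 × Fin n) ⊕ B.V → Prop
  | left (u v : A.V) : A.graph.Adj u v → SandwichAdj H A B x (.inl u) (.inl v)
  | enter (j : Fin n) : SandwichAdj H A B x (.inl (A.output j)) (.inr (.inl (0, j)))
  | middle (u v : Fin 3 × Fin n) : (threeLayer H x).Adj u v →
      SandwichAdj H A B x (.inr (.inl u)) (.inr (.inl v))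
  | leave (j : Fin n) : SandwichAdj H A B x (.inr (.inl (2, j))) (.inr (.inr (B.input j)))
  | right (u v : B.V) : B.graph.Adj u v → SandwichAdj H A B x (.inr (.inr u)) (.inr (.inr v))

/-- The graph `M_n`: the three-layer graph between `A` and `B`; its inputs are the inputs of `A`
and its outputs are the outputs of `B`. -/
def sandwich {n τ : ℕ} (H : Digraph (Fin n)) (A B : IODigraph n) (x : Samples n τ) :
    IODigraph n where
  V := A.V ⊕ (Fin 3 × Fin n) ⊕ B.V
  graph := ⟨SandwichAdj H A B x⟩
  input := A.input.trans Function.Embedding.inl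
  output := (B.output.trans Function.Embedding.inr).trans Function.Embedding.inr

/-- A family `(H_n)` of DAGs, `H_n` with `n` vertices, which have indegree at most `δ` and are
`(c n, n^{2/3})`-depth-robust. -/
def IsDepthRobustFamily (c : ℝ) (δ : ℕ) (H : ∀ n, Digraph (Fin n)) : Prop :=
  ∀ n : ℕ, 1 ≤ n →
    IsDAG (H n) ∧ IndegreeLE (H n) δ ∧ DepthRobust (H n) (c * n) ((n : ℝ) ^ (2 / 3 : ℝ))

/-- A family of `n`-superconcentrators with at most `a n` vertices and indegree at most `δ`. -/
def IsSuperconcentratorFamily (a δ : ℕ) (A : ∀ n, IODigraph n) : Prop :=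
  ∀ n : ℕ, 1 ≤ n →
    IsSuperconcentrator (A n) ∧ Fintype.card (A n).V ≤ a * n ∧ IndegreeLE (A n).graph δ

end STRobustness

/-! Robustness of $M_n$ comes from a hub. Delete a set $D$ of $k \le c'n/2$ vertices. By
depth-robustness, each of the three layers minus $D$ contains $r = O(n^{1/3})$ disjoint paths of $2h
\approx n^{2/3}$ vertices, found greedily and covering a constant fraction of the layer. Cut each
path at its middle. A sampled edge from the second half of a path to the first half of a path in the
next layer connects the middles of the two. For a given $D$, a given pair of layers and a given
quarter of the $r^2$ pairs of paths, having no such edge within these pairs forces linearly many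
vertices to miss linearly large sets in all their samples, which has probability $e^{-\Omega(\tau
n)}$. The paths depend on $D$ only and $r^2 \le n$, so there are $2^{O(n)}$ such events, and for
large $\tau$ all are avoided with probability $1-2^{-n}$ (`card_not_isLinked_le`). Then some path of
the middle layer is linked with more than half of the paths below and more than half of those above
(`IsLinked.exists_hub`). Its middle is the hub: more than $k$ vertices of the first layer reach it,
and it reaches more than $k$ of the third. Since $k$ deletions cannot block $k+1$ disjoint paths of
a superconcentrator, all but at most $k$ inputs reach the hub and all but at most $k$ outputs are
reached from it (`exists_hub_subgraph`).

Linear-size superconcentrators are built recursively: input $i$ has a direct edge to output $i$, and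
both are attached by a bounded-degree concentrator to a superconcentrator of size $3n/4$. The direct
edges serve $X \cap Y$, so at most $n/2$ inputs have to be matched into the smaller network by
Hall's theorem.

The depth-robust graph has $2^K$ blocks, the leaves of a binary tree, each with $K$ incoming and $K$
outgoing ports, one of each per tree level. Mixing bipartite graphs join incoming to outgoing ports
within a block, and left to right blocks below each tree node. After few deletions, label each
vertex by the length of a longest path ending there. The labels induce a level for each block, and
at most nodes the levels nearly separate the left half from the right half. For any fixed level, a
leaf is determined by the set of tree heights at which it lies on the wrong side, so few leaves with
few errors share a level. Hence there are many levels (`two_pow_le_of_misplaced_le`), that is, a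
long path. -/

namespace STRobustness

/-! ### Counting samples that avoid prescribed sets -/

open Classical in
theorem card_samples_avoiding {n τ : ℕ} (F : Fin 2 → Fin n → Finset (Fin n)) :
    (Finset.univ.filter fun x : Samples n τ => ∀ i v t, x i v t ∉ F i v).card =
      ∏ i, ∏ v, (n - (F i v).card) ^ τ := by
  have : (Finset.univ.filter fun x : Samples n τ => ∀ i v t, x i v t ∉ F i v) =
      Fintype.piFinset fun i => Fintype.piFinset fun v => Fintype.piFinset fun _ => (F i v)ᶜ := by
    ext x
    simp [Fintype.mem_piFinset]
  rw [this]
  simp [Fintype.card_piFinset, Finset.card_compl]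

open Classical in
/-- If the samples of at least `w` vertices of the upper layer `s` have to avoid sets of size at
least `θ n`, this happens with probability at most `(1 - θ) ^ (τ w)`. -/
theorem card_samples_avoiding_le {n τ w : ℕ} {θ : ℝ} (hn : 0 < n) (hθ0 : 0 ≤ θ) (hθ : θ ≤ 1)
    (F : Fin 2 → Fin n → Finset (Fin n)) (s : Fin 2)
    (hw : w ≤ (Finset.univ.filter fun v => θ * n ≤ ((F s v).card : ℝ)).card) :
    ((Finset.univ.filter fun x : Samples n τ => ∀ i v t, x i v t ∉ F i v).card : ℝ) ≤
      (1 - θ) ^ (τ * w) * Fintype.card (Samples n τ) := by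
  have hn' : (0 : ℝ) < n := by exact_mod_cast hn
  rw [card_samples_avoiding]
  set T := Finset.univ.filter fun v => θ * n ≤ ((F s v).card : ℝ) with hT
  have key : ∀ i v, (((n - (F i v).card : ℕ) : ℝ)) ^ τ ≤
      (if i = s ∧ v ∈ T then (1 - θ) ^ τ else 1) * (n : ℝ) ^ τ := by
    intro i v
    have hle : (F i v).card ≤ n := by simpa using Finset.card_le_univ (F i v)
    split_ifs with h
    · rw [← mul_pow]
      refine pow_le_pow_left₀ (by positivity) ?_ _
      rw [Nat.cast_sub hle]
      have := h.2
      rw [hT, Finset.mem_filter] at this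
      rw [h.1]
      linarith [this.2]
    · rw [one_mul]
      refine pow_le_pow_left₀ (by positivity) ?_ _
      exact_mod_cast Nat.sub_le _ _
  have h1 : ((∏ i, ∏ v, (n - (F i v).card) ^ τ : ℕ) : ℝ) ≤
      ∏ i, ∏ v, ((if i = s ∧ v ∈ T then (1 - θ) ^ τ else 1) * (n : ℝ) ^ τ) := by
    push_cast
    refine Finset.prod_le_prod (fun _ _ => by positivity) fun i _ => ?_
    exact Finset.prod_le_prod (fun _ _ => by positivity) fun v _ => key i v
  refine h1.trans ?_
  have h2 : (Fintype.card (Samples n τ) : ℝ) = ∏ _i : Fin 2, ∏ _v : Fin n, (n : ℝ) ^ τ := by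
    simp [Samples]
  rw [h2]
  simp only [Finset.prod_mul_distrib]
  refine mul_le_mul_of_nonneg_right ?_ (by positivity)
  have h3 : (∏ i : Fin 2, ∏ v : Fin n, if i = s ∧ v ∈ T then (1 - θ) ^ τ else (1 : ℝ)) =
      (1 - θ) ^ (τ * T.card) := by
    rw [Finset.prod_eq_single s]
    · simp only [true_and]
      rw [Finset.prod_ite_mem, Finset.univ_inter, Finset.prod_const, pow_mul]
    · intro i _ hi
      simp [hi]
    · simp
  rw [h3]
  exact pow_le_pow_of_le_one (by linarith) (by linarith) (Nat.mul_le_mul_left _ hw)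

-- Union bound; the pair of layers on which the avoidance is costly may depend on the event.
open Classical in
theorem card_samples_exists_avoiding_le {n τ w : ℕ} {θ : ℝ} (hn : 0 < n) (hθ0 : 0 ≤ θ) (hθ : θ ≤ 1)
    {ι : Type*} (I : Finset ι) (F : ι → Fin 2 → Fin n → Finset (Fin n)) (s : ι → Fin 2)
    (hw : ∀ k ∈ I, w ≤ (Finset.univ.filter fun v => θ * n ≤ ((F k (s k) v).card : ℝ)).card) :
    ((Finset.univ.filter fun x : Samples n τ => ∃ k ∈ I, ∀ i v t, x i v t ∉ F k i v).card : ℝ) ≤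
      I.card * ((1 - θ) ^ (τ * w) * Fintype.card (Samples n τ)) := by
  have : (Finset.univ.filter fun x : Samples n τ => ∃ k ∈ I, ∀ i v t, x i v t ∉ F k i v) ⊆
      I.biUnion fun k => Finset.univ.filter fun x : Samples n τ => ∀ i v t, x i v t ∉ F k i v := by
    intro x
    simp
  have h1 := (Finset.card_le_card this).trans Finset.card_biUnion_le
  calc _ ≤ ((∑ k ∈ I, (Finset.univ.filter fun x : Samples n τ =>
        ∀ i v t, x i v t ∉ F k i v).card : ℕ) : ℝ) := by exact_mod_cast h1
    _ ≤ ∑ k ∈ I, ((1 - θ) ^ (τ * w) * Fintype.card (Samples n τ)) := by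
        push_cast
        exact Finset.sum_le_sum fun k hk =>
          card_samples_avoiding_le hn hθ0 hθ (F k) (s k) (hw k hk)
    _ = _ := by simp

/-- The base $1/64$ is small enough for both union bounds made later, over $4^n$ and over $2 \cdot
16^n$ events; the latter still leaves a failure probability of at most $2^{-n}$. -/
theorem exists_sampling_rate {θ : ℝ} (hθ0 : 0 < θ) (hθ : θ ≤ 1) :
    ∃ τ₀ : ℕ, ∀ τ, τ₀ ≤ τ → ∀ n w : ℕ, θ * n ≤ w → (1 - θ) ^ (τ * w) ≤ (1 / 64 : ℝ) ^ n := by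
  obtain ⟨s, hs⟩ := exists_pow_lt_of_lt_one (show (0 : ℝ) < 1 / 64 by norm_num)
    (show 1 - θ < 1 by linarith)
  obtain ⟨q, hq⟩ := exists_nat_ge (1 / θ)
  refine ⟨s * q, fun τ hτ n w hw => ?_⟩
  have h1 : n ≤ q * w := by
    have : (n : ℝ) ≤ q * w := by
      rw [div_le_iff₀ hθ0] at hq
      have hq0 : (0 : ℝ) ≤ q := by positivity
      nlinarith [mul_le_mul_of_nonneg_left hw hq0, (Nat.cast_nonneg n : (0 : ℝ) ≤ n)]
    exact_mod_cast this
  have h2 : s * n ≤ τ * w := by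
    calc s * n ≤ s * (q * w) := Nat.mul_le_mul_left _ h1
      _ = s * q * w := by ring
      _ ≤ τ * w := Nat.mul_le_mul_right _ hτ
  calc (1 - θ) ^ (τ * w) ≤ (1 - θ) ^ (s * n) :=
        pow_le_pow_of_le_one (by linarith) (by linarith) h2
    _ = ((1 - θ) ^ s) ^ n := pow_mul _ _ _
    _ ≤ _ := pow_le_pow_left₀ (pow_nonneg (by linarith) _) hs.le _

open Classical in
/-- Bipartite graphs on `range N`, `range N` of bounded indegree which have an edge between any two
sets of size at least `η N`. -/
theorem exists_mixing {η : ℝ} (hη0 : 0 < η) (hη : η ≤ 1) :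
    ∃ (τ : ℕ) (E : ℕ → ℕ → Finset ℕ), (∀ N y, (E N y).card ≤ τ) ∧
      ∀ N, 0 < N → ∀ X Y : Finset ℕ, X ⊆ Finset.range N → Y ⊆ Finset.range N →
        η * N ≤ X.card → η * N ≤ Y.card → ∃ y ∈ Y, ∃ x ∈ X, x ∈ E N y := by
  obtain ⟨τ, hτ⟩ := exists_sampling_rate hη0 hη
  have main : ∀ N : ℕ, 0 < N → ∃ x : Samples N τ, ∀ X Y : Finset (Fin N),
      η * N ≤ X.card → η * N ≤ Y.card → ∃ y ∈ Y, ∃ t, x 0 y t ∈ X := by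
    intro N hN
    by_contra! hcon
    set I : Finset (Finset (Fin N) × Finset (Fin N)) :=
      Finset.univ.filter fun k => η * N ≤ k.1.card ∧ η * N ≤ k.2.card with hI
    -- Only one bipartite graph is wanted: the samples of the pair of layers $0$ are used, and those
    -- of the other pair are unconstrained.
    set F : Finset (Fin N) × Finset (Fin N) → Fin 2 → Fin N → Finset (Fin N) :=
      fun k i v => if i = 0 ∧ v ∈ k.2 then k.1 else ∅ with hF
    have h1 := card_samples_exists_avoiding_le (n := N) (τ := τ) (w := ⌈η * N⌉₊) (θ := η) hN
      hη0.le hη I F (fun _ => 0) (by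
        intro k hk
        rw [hI, Finset.mem_filter] at hk
        refine (Nat.ceil_le.2 hk.2.2).trans (Finset.card_le_card fun v hv => ?_)
        simp [hF, hv, hk.2.1])
    have h2 : (Finset.univ.filter fun x : Samples N τ => ∃ k ∈ I, ∀ i v t, x i v t ∉ F k i v) =
        Finset.univ := by
      ext x
      simp only [Finset.mem_filter, Finset.mem_univ, true_and, iff_true]
      obtain ⟨X, Y, hX, hY, h⟩ := hcon x
      refine ⟨(X, Y), by simp [hI, hX, hY], fun i v t => ?_⟩
      simp only [hF]
      split_ifs with hv
      · rw [hv.1]; exact h v hv.2 t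
      · simp
    rw [h2, Finset.card_univ] at h1
    have : Nonempty (Fin N) := ⟨⟨0, hN⟩⟩
    have hpos : (0 : ℝ) < Fintype.card (Samples N τ) := by exact_mod_cast Fintype.card_pos
    have h3 := hτ τ le_rfl N ⌈η * N⌉₊ (Nat.le_ceil _)
    -- At most $4^N$ pairs of sets against probability at most $64^{-N}$ each.
    have h4 : (I.card : ℝ) ≤ 4 ^ N := by
      have : I.card ≤ 4 ^ N := by
        refine (Finset.card_le_univ I).trans ?_
        simp [← mul_pow]
      exact_mod_cast this
    have h5 : (I.card : ℝ) * (1 - η) ^ (τ * ⌈η * N⌉₊) < 1 := by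
      calc (I.card : ℝ) * (1 - η) ^ (τ * ⌈η * N⌉₊) ≤ 4 ^ N * (1 / 64) ^ N :=
            mul_le_mul h4 h3 (pow_nonneg (by linarith) _) (by positivity)
        _ = (1 / 16) ^ N := by rw [← mul_pow]; norm_num
        _ < 1 := pow_lt_one₀ (by norm_num) (by norm_num) hN.ne'
    nlinarith
  choose x hx using main
  refine ⟨τ, fun N y => if h : y < N then
    Finset.univ.image fun t => ((x N (by omega) 0 ⟨y, h⟩ t : Fin N) : ℕ) else ∅, ?_, ?_⟩
  · intro N y
    dsimp only
    split_ifs with h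
    · exact Finset.card_image_le.trans (by simp)
    · simp
  · intro N hN X Y hXN hYN hX hY
    have hc : ∀ Z : Finset ℕ, Z ⊆ Finset.range N →
        (Finset.univ.filter fun v : Fin N => (v : ℕ) ∈ Z).card = Z.card := by
      intro Z hZ
      rw [← Finset.card_map Fin.valEmbedding]
      congr 1
      ext a
      simp only [Finset.mem_map, Finset.mem_filter, Finset.mem_univ, true_and,
        Fin.valEmbedding_apply]
      constructor
      · rintro ⟨b, hb, rfl⟩; exact hb
      · intro ha; exact ⟨⟨a, Finset.mem_range.1 (hZ ha)⟩, ha, rfl⟩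
    obtain ⟨y, hy, t, ht⟩ := hx N hN (Finset.univ.filter fun v : Fin N => (v : ℕ) ∈ X)
      (Finset.univ.filter fun v : Fin N => (v : ℕ) ∈ Y) (by rwa [hc X hXN]) (by rwa [hc Y hYN])
    rw [Finset.mem_filter] at hy ht
    refine ⟨y, hy.2, _, ht.2, ?_⟩
    simp


/-! ### Reachability after deletions and halved paths -/

/-- Adjacency in `G - D`. -/
def DelAdj {V : Type} (G : Digraph V) (D : Finset V) (u v : V) : Prop :=
  G.Adj u v ∧ u ∉ D ∧ v ∉ D

theorem DelAdj.mono {V : Type} {G : Digraph V} {D E : Finset V} (h : D ⊆ E) {u v : V}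
    (huv : DelAdj G E u v) : DelAdj G D u v :=
  ⟨huv.1, fun hu => huv.2.1 (h hu), fun hv => huv.2.2 (h hv)⟩

theorem IsPath.isChain_delAdj {V : Type} {G : Digraph V} {D : Finset V} {p : List V}
    (hp : IsPath G p) (hD : ∀ v ∈ p, v ∉ D) : p.IsChain (DelAdj G D) := by
  have h := hp.2.1
  clear hp
  induction p with
  | nil => simp
  | cons a p ih =>
    cases p with
    | nil => simp
    | cons b p =>
      rw [List.isChain_cons_cons] at h ⊢
      exact ⟨⟨h.1, hD _ (by simp), hD _ (by simp)⟩,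
        ih (fun v hv => hD v (List.mem_cons_of_mem _ hv)) h.2⟩

theorem IsPath.pairwise_reach {V : Type} {G : Digraph V} {D : Finset V} {p : List V}
    (hp : IsPath G p) (hD : ∀ v ∈ p, v ∉ D) :
    p.Pairwise (Relation.ReflTransGen (DelAdj G D)) := by
  have h := (hp.isChain_delAdj hD).imp fun a b hab => Relation.ReflTransGen.single hab
  exact List.isChain_iff_pairwise.1 h

theorem IsPathFromTo.reach {V : Type} {G : Digraph V} {D : Finset V} {s t : V} {p : List V}
    (hp : IsPathFromTo G s t p) (hD : ∀ v ∈ p, v ∉ D) :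
    Relation.ReflTransGen (DelAdj G D) s t := by
  obtain ⟨hp, hs, ht⟩ := hp
  cases p with
  | nil => simp at hs
  | cons a p =>
    simp only [List.head?_cons, Option.some.injEq] at hs
    subst hs
    rw [List.getLast?_eq_some_iff] at ht
    obtain ⟨q, hq⟩ := ht
    cases q with
    | nil => simp at hq; rw [hq.1]
    | cons b q =>
      simp only [List.cons_append, List.cons.injEq] at hq
      have := hp.pairwise_reach hD
      rw [List.pairwise_cons] at this
      exact this.1 t (by rw [hq.2]; simp)

/-- `A` and `B` are the two halves of a path in `G - D`, and `z` is a vertex between them. -/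
structure IsHalves {V : Type} (G : Digraph V) (D : Finset V) (h : ℕ) (A B : Finset V) (z : V) :
    Prop where
  card_left : A.card = h
  card_right : B.card = h
  left_notMem : ∀ a ∈ A, a ∉ D
  right_notMem : ∀ b ∈ B, b ∉ D
  left_reach : ∀ a ∈ A, Relation.ReflTransGen (DelAdj G D) a z
  right_reach : ∀ b ∈ B, Relation.ReflTransGen (DelAdj G D) z b

theorem IsHalves.mono {V : Type} {G : Digraph V} {D E : Finset V} (hDE : D ⊆ E) {h : ℕ}
    {A B : Finset V} {z : V} (H : IsHalves G E h A B z) : IsHalves G D h A B z :=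
  ⟨H.1, H.2, fun a ha hD => H.3 a ha (hDE hD), fun a ha hD => H.4 a ha (hDE hD),
    fun a ha => (H.5 a ha).lift id fun _ _ => DelAdj.mono hDE,
    fun a ha => (H.6 a ha).lift id fun _ _ => DelAdj.mono hDE⟩

/-- Cutting a path of at least $2h$ vertices after its first $h$ ones. The halves serve as targets:
any edge from a right half to the left half of another path connects the two cut vertices. -/
theorem DepthRobust.exists_isHalves {V : Type} [DecidableEq V] {G : Digraph V} {e d : ℝ}
    (hG : DepthRobust G e d) {h : ℕ} (hh : 0 < h) (hd : (2 * h : ℕ) ≤ d) (D : Finset V)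
    (hD : (D.card : ℝ) ≤ e) : ∃ A B z, IsHalves G D h A B z := by
  obtain ⟨p, hp, hpD, hlen⟩ := hG D hD
  have hlen' : 2 * h ≤ p.length := by exact_mod_cast hd.trans hlen
  have hpw := hp.pairwise_reach hpD
  have hsplit := List.take_append_drop h p
  set p₁ := p.take h with h1
  set p₂ := p.drop h with h2
  have hl1 : p₁.length = h := by simp [h1]; omega
  have hl2 : h ≤ p₂.length := by simp [h2]; omega
  have hnd := hp.2.2
  rw [← hsplit] at hnd hpw
  rw [List.pairwise_append] at hpw
  have hnd1 := hnd.of_append_left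
  have hnd2 := hnd.of_append_right
  have hm1 : ∀ a ∈ p₁, a ∉ D := fun a ha => hpD a (List.mem_of_mem_take ha)
  have hm2 : ∀ a ∈ p₂, a ∉ D := fun a ha => hpD a (List.mem_of_mem_drop ha)
  -- The cut vertex is the first one of the second half.
  obtain ⟨z, q, hq⟩ : ∃ z q, p₂ = z :: q := by
    cases hc : p₂ with
    | nil => rw [hc] at hl2; simp at hl2; omega
    | cons z q => exact ⟨z, q, rfl⟩
  refine ⟨p₁.toFinset, (p₂.take h).toFinset, z, ?_, ?_, ?_, ?_, ?_, ?_⟩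
  · rw [List.toFinset_card_of_nodup hnd1, hl1]
  · rw [List.toFinset_card_of_nodup (hnd2.sublist (List.take_sublist _ _)), List.length_take]
    omega
  · intro a ha; exact hm1 a (by simpa using ha)
  · intro a ha; exact hm2 a (List.mem_of_mem_take (by simpa using ha))
  · intro a ha
    exact hpw.2.2 a (by simpa using ha) z (by simp [hq])
  · intro b hb
    have hb' : b ∈ p₂ := List.mem_of_mem_take (by simpa using hb)
    have h3 := hpw.2.1
    rw [hq] at h3 hb'
    rw [List.pairwise_cons] at h3
    rcases List.mem_cons.1 hb' with rfl | hb'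
    · exact .refl
    · exact h3.1 b hb'

/-- A system of `r` disjoint halved paths in `G - D`. -/
structure IsHalvesSystem {V : Type} (G : Digraph V) (D : Finset V) (h r : ℕ)
    (A B : Fin r → Finset V) (z : Fin r → V) : Prop where
  isHalves : ∀ j, IsHalves G D h (A j) (B j) (z j)
  left_disjoint : Pairwise fun i j => Disjoint (A i) (A j)
  right_disjoint : Pairwise fun i j => Disjoint (B i) (B j)

/-- Greedy choice: the halves found so far are added to the deleted set, at a cost of $2h$ vertices
each. -/
theorem DepthRobust.exists_isHalvesSystem {V : Type} [DecidableEq V] {G : Digraph V} {e d : ℝ}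
    (hG : DepthRobust G e d) {h : ℕ} (hh : 0 < h) (hd : (2 * h : ℕ) ≤ d) (D : Finset V) (r : ℕ)
    (hD : (D.card + r * (2 * h) : ℝ) ≤ e) : ∃ A B z, IsHalvesSystem G D h r A B z := by
  induction r with
  | zero =>
    exact ⟨Fin.elim0, Fin.elim0, Fin.elim0, fun j => j.elim0, fun j => j.elim0, fun j => j.elim0⟩
  | succ r ih =>
    push_cast at hD
    have hh0 : (0 : ℝ) ≤ h := by positivity
    obtain ⟨A, B, z, hAB⟩ := ih (by nlinarith)
    set U := Finset.univ.biUnion fun j => A j ∪ B j with hU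
    have hUc : U.card ≤ r * (2 * h) := by
      refine Finset.card_biUnion_le.trans ?_
      calc ∑ j, (A j ∪ B j).card ≤ ∑ _j : Fin r, 2 * h := by
            refine Finset.sum_le_sum fun j _ => (Finset.card_union_le _ _).trans ?_
            rw [(hAB.1 j).1, (hAB.1 j).2]; omega
        _ = _ := by simp
    have hc : ((D ∪ U).card : ℝ) ≤ e := by
      have h1 : ((D ∪ U).card : ℝ) ≤ D.card + r * (2 * h) := by
        exact_mod_cast (Finset.card_union_le _ _).trans (Nat.add_le_add_left hUc _)
      nlinarith
    obtain ⟨A', B', z', h'⟩ := hG.exists_isHalves hh hd (D ∪ U) hc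
    have hdA : ∀ j, Disjoint A' (A j) := fun j => Finset.disjoint_left.2 fun a ha haj =>
      h'.3 a ha (Finset.mem_union_right _ (Finset.mem_biUnion.2
        ⟨j, Finset.mem_univ _, Finset.mem_union_left _ haj⟩))
    have hdB : ∀ j, Disjoint B' (B j) := fun j => Finset.disjoint_left.2 fun a ha haj =>
      h'.4 a ha (Finset.mem_union_right _ (Finset.mem_biUnion.2
        ⟨j, Finset.mem_univ _, Finset.mem_union_right _ haj⟩))
    refine ⟨Fin.cons A' A, Fin.cons B' B, Fin.cons z' z, ?_, ?_, ?_⟩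
    · intro j
      refine Fin.cases ?_ (fun j => ?_) j
      · simpa using h'.mono Finset.subset_union_left
      · simpa using hAB.1 j
    · intro i j
      refine Fin.cases ?_ (fun i => ?_) i <;> refine Fin.cases ?_ (fun j => ?_) j
      · simp
      · intro _; simpa using hdA j
      · intro _; simpa using (hdA i).symm
      · intro hij; simpa using hAB.2 (by simpa using hij)
    · intro i j
      refine Fin.cases ?_ (fun i => ?_) i <;> refine Fin.cases ?_ (fun j => ?_) j
      · simp
      · intro _; simpa using hdB j
      · intro _; simpa using (hdB i).symm
      · intro hij; simpa using hAB.3 (by simpa using hij)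

/-! ### Superconcentrators around a hub -/

/-- In a superconcentrator minus `k` vertices, some vertex of any `k + 1` inputs is still connected
with some vertex of any `k + 1` outputs. -/
theorem IsSuperconcentrator.exists_reach {n : ℕ} {G : IODigraph n} (hG : IsSuperconcentrator G)
    (D : Finset G.V) {k : ℕ} (hD : D.card ≤ k) (X Y : Finset (Fin n)) (hX : k < X.card)
    (hY : k < Y.card) :
    ∃ i ∈ X, ∃ j ∈ Y, Relation.ReflTransGen (DelAdj G.graph D) (G.input i) (G.output j) ∧
      G.input i ∉ D ∧ G.output j ∉ D := by
  classical
  obtain ⟨X', hX', hXc⟩ := Finset.exists_subset_card_eq (show k + 1 ≤ X.card by omega)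
  obtain ⟨Y', hY', hYc⟩ := Finset.exists_subset_card_eq (show k + 1 ≤ Y.card by omega)
  obtain ⟨f, p, hf, hp, hdis⟩ := hG.2 X' Y' (by omega)
  -- If all $k+1$ disjoint paths met $D$, choosing a deleted vertex on each would inject $k+1$
  -- indices into $D$.
  by_cases hall : ∀ i ∈ X', ∃ v ∈ p i, v ∈ D
  · exfalso
    have : Nonempty G.V := by
      obtain ⟨i, hi⟩ : X'.Nonempty := Finset.card_pos.1 (by omega)
      exact ⟨G.input i⟩
    choose! g hg1 hg2 using hall
    have := Finset.card_le_card_of_injOn g (s := X') (t := D) hg2 (by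
      intro i hi j hj hij
      by_contra hne
      exact hdis i hi j hj hne (hg1 i hi) (by rw [hij]; exact hg1 j hj))
    omega
  · push Not at hall
    obtain ⟨i, hi, hiD⟩ := hall
    refine ⟨i, hX' hi, f i, hY' (by exact_mod_cast hf.mapsTo hi), (hp i hi).reach hiD, ?_, ?_⟩
    · exact hiD _ (List.mem_of_mem_head? (by rw [(hp i hi).2.1]; rfl))
    · exact hiD _ (List.mem_of_getLast? (hp i hi).2.2)

/-- The graph of `sandwich H A B x`, with its vertex type spelled out. -/
abbrev sandwichGraph {n τ : ℕ} (H : Digraph (Fin n)) (A B : IODigraph n) (x : Samples n τ) :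
    Digraph (A.V ⊕ (Fin 3 × Fin n) ⊕ B.V) :=
  ⟨SandwichAdj H A B x⟩

/-- If a set of more than `k` vertices is linked to the hub `z` of the middle part, on either side,
then the sandwich minus at most `k` vertices connects `n - k` inputs with `n - k` outputs. -/
theorem exists_hub_subgraph {n τ : ℕ} {H : Digraph (Fin n)} {A B : IODigraph n}
    (hA : IsSuperconcentrator A) (hB : IsSuperconcentrator B) (x : Samples n τ)
    (D : Finset (A.V ⊕ (Fin 3 × Fin n) ⊕ B.V)) {k : ℕ} (hD : D.card ≤ k) (D' : Finset (Fin 3 × Fin n))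
    (hD' : ∀ v, v ∈ D' ↔ Sum.inr (Sum.inl v) ∈ D)
    (z : Fin 3 × Fin n) (U U' : Finset (Fin n)) (hU : k < U.card)
    (hU' : k < U'.card)
    (hUz : ∀ u ∈ U, (0, u) ∉ D' ∧ Relation.ReflTransGen (DelAdj (threeLayer H x) D') (0, u) z)
    (hzU : ∀ u ∈ U', (2, u) ∉ D' ∧ Relation.ReflTransGen (DelAdj (threeLayer H x) D') z (2, u)) :
    ∃ (W : Set (A.V ⊕ (Fin 3 × Fin n) ⊕ B.V)) (F : Digraph (A.V ⊕ (Fin 3 × Fin n) ⊕ B.V)),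
      (∀ v ∈ W, v ∉ D) ∧
      (∀ u v, F.Adj u v → u ∈ W ∧ v ∈ W ∧ (sandwichGraph H A B x).Adj u v) ∧
      n - k ≤ ((Set.range fun i => Sum.inl (A.input i)) ∩ W).ncard ∧
      n - k ≤ ((Set.range fun i => Sum.inr (Sum.inr (B.output i))) ∩ W).ncard ∧
      ∀ s ∈ (Set.range fun i => Sum.inl (A.input i)) ∩ W,
        ∀ t ∈ (Set.range fun i => Sum.inr (Sum.inr (B.output i))) ∩ W, Relation.ReflTransGen F.Adj s t := by
  classical
  set M := sandwichGraph H A B x with hM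
  set R := Relation.ReflTransGen (DelAdj M D) with hR
  set c : (A.V ⊕ (Fin 3 × Fin n) ⊕ B.V) := Sum.inr (Sum.inl z) with hc
  have hmid : ∀ u v, Relation.ReflTransGen (DelAdj (threeLayer H x) D') u v →
      R (Sum.inr (Sum.inl u)) (Sum.inr (Sum.inl v)) := by
    intro u v huv
    refine huv.lift (fun u => (Sum.inr (Sum.inl u) : A.V ⊕ (Fin 3 × Fin n) ⊕ B.V))
      fun a b hab => ⟨SandwichAdj.middle a b hab.1, ?_, ?_⟩
    · exact fun h => hab.2.1 ((hD' a).2 h)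
    · exact fun h => hab.2.2 ((hD' b).2 h)
  -- Edges never go back from right to middle or from middle to left. So an input in `W` must reach
  -- the hub rather than be reached from it, and dually for outputs.
  let lev : A.V ⊕ (Fin 3 × Fin n) ⊕ B.V → ℕ := Sum.elim (fun _ => 0) (Sum.elim (fun _ => 1) fun _ => 2)
  have hlev : ∀ u v, R u v → lev u ≤ lev v := by
    intro u v huv
    induction huv with
    | refl => exact le_rfl
    | tail _ h ih =>
      refine ih.trans ?_
      cases h.1 <;> simp [lev]
  -- The subgraph consists of the surviving vertices comparable with the hub. Paths to or from the
  -- hub in $M - D$ stay inside it.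
  set W : Set (A.V ⊕ (Fin 3 × Fin n) ⊕ B.V) := {v | v ∉ D ∧ (R v c ∨ R c v)} with hW
  set F : Digraph (A.V ⊕ (Fin 3 × Fin n) ⊕ B.V) := ⟨fun u v => u ∈ W ∧ v ∈ W ∧ M.Adj u v⟩ with hF
  have hto : ∀ v, R v c → Relation.ReflTransGen F.Adj v c := by
    intro v hv
    induction hv using Relation.ReflTransGen.head_induction_on with
    | refl => exact .refl
    | head h h' ih =>
      exact ih.head ⟨⟨h.2.1, Or.inl (h'.head h)⟩, ⟨h.2.2, Or.inl h'⟩, h.1⟩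
  have hfrom : ∀ v, R c v → Relation.ReflTransGen F.Adj c v := by
    intro v hv
    induction hv with
    | refl => exact .refl
    | tail h' h ih =>
      exact ih.tail ⟨⟨h.2.1, Or.inr h'⟩, ⟨h.2.2, Or.inr (h'.tail h)⟩, h.1⟩
  have hcount : ∀ (g : Fin n ↪ (A.V ⊕ (Fin 3 × Fin n) ⊕ B.V)) (P : Finset (Fin n)), (∀ i, i ∉ P → g i ∈ W) → P.card ≤ k →
      n - k ≤ (Set.range g ∩ W).ncard := by
    intro g P hP hPk
    have h1 : (Pᶜ.map g : Set (A.V ⊕ (Fin 3 × Fin n) ⊕ B.V)) ⊆ Set.range g ∩ W := by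
      intro v hv
      simp only [Finset.coe_map, Set.mem_image, Finset.mem_coe, Finset.mem_compl] at hv
      obtain ⟨i, hi, rfl⟩ := hv
      exact ⟨⟨i, rfl⟩, hP i hi⟩
    have h2 := Set.ncard_le_ncard h1 (Set.toFinite _)
    rw [Set.ncard_coe_finset, Finset.card_map, Finset.card_compl, Fintype.card_fin] at h2
    omega
  refine ⟨W, F, fun v hv => hv.1, fun u v h => h, ?_, ?_, ?_⟩
  · set P := Finset.univ.filter fun i => Sum.inl (A.input i) ∉ W with hP
    refine hcount (A.input.trans Function.Embedding.inl) P (fun i hi => by simpa [hP] using hi) ?_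
    -- Otherwise, more than `k` bad inputs face the more than `k` outputs of `A` attached to `U`.
    -- Some path between them avoids `D`, and continuing through `U` it takes a bad input to the
    -- hub.
    by_contra! hcard
    have hDA : (D.preimage Sum.inl Sum.inl_injective.injOn).card ≤ k :=
      (Finset.card_le_card_of_injOn Sum.inl (fun a ha => by simpa using ha)
        Sum.inl_injective.injOn).trans hD
    obtain ⟨i, hi, j, hj, hij, hiD, hjD⟩ := hA.exists_reach _ hDA P U hcard hU
    rw [hP, Finset.mem_filter] at hi
    have h0 := (hUz j hj).1
    rw [hD'] at h0
    rw [Finset.mem_preimage] at hiD hjD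
    refine hi.2 ⟨hiD, Or.inl ?_⟩
    have h1 : R (Sum.inl (A.input i)) (Sum.inl (A.output j)) :=
      hij.lift _ fun a b hab => ⟨SandwichAdj.left a b hab.1,
        fun h => hab.2.1 (by simpa using h), fun h => hab.2.2 (by simpa using h)⟩
    have h2 : DelAdj M D (Sum.inl (A.output j)) (Sum.inr (Sum.inl (0, j))) :=
      ⟨SandwichAdj.enter j, hjD, h0⟩
    exact (h1.tail h2).trans (hmid _ _ (hUz j hj).2)
  · set P := Finset.univ.filter fun i => Sum.inr (Sum.inr (B.output i)) ∉ W with hP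
    refine hcount ((B.output.trans Function.Embedding.inr).trans Function.Embedding.inr) P (fun i hi => by simpa [hP] using hi) ?_
    by_contra! hcard
    have hinj : Function.Injective (fun b : B.V => (Sum.inr (Sum.inr b) : (A.V ⊕ (Fin 3 × Fin n) ⊕ B.V))) :=
      Sum.inr_injective.comp Sum.inr_injective
    have hDB : (D.preimage _ hinj.injOn).card ≤ k :=
      (Finset.card_le_card_of_injOn _ (fun a ha => by simpa using ha) hinj.injOn).trans hD
    obtain ⟨i, hi, j, hj, hij, hiD, hjD⟩ := hB.exists_reach _ hDB U' P hU' hcard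
    rw [hP, Finset.mem_filter] at hj
    have h0 := (hzU i hi).1
    rw [hD'] at h0
    rw [Finset.mem_preimage] at hiD hjD
    refine hj.2 ⟨hjD, Or.inr ?_⟩
    have h1 : R (Sum.inr (Sum.inr (B.input i))) (Sum.inr (Sum.inr (B.output j))) :=
      hij.lift (fun b : B.V => (Sum.inr (Sum.inr b) : (A.V ⊕ (Fin 3 × Fin n) ⊕ B.V))) fun a b hab =>
        ⟨SandwichAdj.right a b hab.1,
        fun h => hab.2.1 (by simpa using h), fun h => hab.2.2 (by simpa using h)⟩
    have h2 : DelAdj M D (Sum.inr (Sum.inl (2, i))) (Sum.inr (Sum.inr (B.input i))) :=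
      ⟨SandwichAdj.leave i, h0, hiD⟩
    exact ((hmid _ _ (hzU i hi).2).tail h2).trans h1
  · rintro _ ⟨⟨i, rfl⟩, hi⟩ _ ⟨⟨j, rfl⟩, hj⟩
    have h1 : R (Sum.inl (A.input i)) c := by
      rcases hi.2 with h | h
      · exact h
      · have := hlev _ _ h
        simp [lev, hc] at this
    have h2 : R c (Sum.inr (Sum.inr (B.output j))) := by
      rcases hj.2 with h | h
      · have := hlev _ _ h
        simp [lev, hc] at this
      · exact h
    exact (hto _ h1).trans (hfrom _ h2)


/-! ### Linking the paths of consecutive layers -/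

/-- Light columns contribute less than $r^2/8$ in total and each heavy one at most $r$, so fewer
than $r/8$ heavy columns could not hold $r^2/4$ pairs. This turns many unlinked pairs of paths into
many vertices that each have many forbidden samples. -/
theorem card_heavy_columns {r : ℕ} (hr : 0 < r) (R : Finset (Fin r × Fin r))
    (hR : r * r ≤ 4 * R.card) :
    r ≤ 8 * (Finset.univ.filter fun j =>
      r ≤ 8 * (Finset.univ.filter fun i => (i, j) ∈ R).card).card := by
  set J := Finset.univ.filter fun j =>
      r ≤ 8 * (Finset.univ.filter fun i => (i, j) ∈ R).card with hJ
  by_contra! hlt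
  have h1 : R.card = ∑ j, (Finset.univ.filter fun i => (i, j) ∈ R).card := by
    rw [Finset.card_eq_sum_card_fiberwise (f := Prod.snd) (t := Finset.univ) (by simp)]
    refine Finset.sum_congr rfl fun j _ => ?_
    refine Finset.card_bij' (fun p _ => p.1) (fun i _ => (i, j)) ?_ ?_ ?_ ?_
    · rintro ⟨a, b⟩ h
      simp only [Finset.mem_filter] at h
      obtain ⟨h, rfl⟩ := h
      simpa using h
    · intro a h; simpa using h
    · rintro ⟨a, b⟩ h
      simp only [Finset.mem_filter] at h
      rw [h.2]
    · intros; rfl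
  have h2 : 8 * R.card ≤ ∑ j : Fin r, (r + if j ∈ J then 8 * r else 0) := by
    rw [h1, Finset.mul_sum]
    refine Finset.sum_le_sum fun j _ => ?_
    split_ifs with hj
    · have := Finset.card_le_univ (Finset.univ.filter fun i => (i, j) ∈ R)
      rw [Fintype.card_fin] at this
      omega
    · simp only [hJ, Finset.mem_filter, Finset.mem_univ, true_and] at hj
      omega
  rw [Finset.sum_add_distrib, Finset.sum_ite_mem, Finset.univ_inter] at h2
  simp only [Finset.sum_const, Finset.card_univ, Fintype.card_fin, smul_eq_mul] at h2
  nlinarith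

/-- The vertices in layer `i` of a set of vertices of the three-layer graph. -/
def slice {n : ℕ} (D : Finset (Fin 3 × Fin n)) (i : Fin 3) : Finset (Fin n) :=
  Finset.univ.filter fun v => (i, v) ∈ D

theorem card_slice_le {n : ℕ} (D : Finset (Fin 3 × Fin n)) (i : Fin 3) :
    (slice D i).card ≤ D.card :=
  Finset.card_le_card_of_injOn (fun v => (i, v)) (fun v hv => by simpa [slice] using hv)
    fun _ _ _ _ h => by simpa using h

/-- For every small set `D`, there are systems of `r` halved paths in the three layers minus `D`
such that few pairs of paths in consecutive layers are not joined by a sampled edge. -/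
def IsLinked {n τ : ℕ} (H : Digraph (Fin n)) (e : ℝ) (h r : ℕ) (x : Samples n τ) : Prop :=
  ∀ D : Finset (Fin 3 × Fin n), (D.card : ℝ) ≤ e →
    ∃ (A B : Fin 3 → Fin r → Finset (Fin n)) (z : Fin 3 → Fin r → Fin n),
      (∀ i, IsHalvesSystem H (slice D i) h r (A i) (B i) (z i)) ∧
      ∀ (s : Fin 2) (R : Finset (Fin r × Fin r)), r * r ≤ 4 * R.card →
        ∃ p ∈ R, ∃ v ∈ A s.succ p.2, ∃ t, x s v t ∈ B s.castSucc p.1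

theorem card_biUnion_halves {V : Type} [DecidableEq V] {r h : ℕ} {A : Fin r → Finset V}
    (hA : ∀ j, (A j).card = h) (hdis : Pairwise fun i j => Disjoint (A i) (A j))
    (J : Finset (Fin r)) : (J.biUnion A).card = J.card * h := by
  rw [Finset.card_biUnion fun i _ j _ hij => hdis hij]
  simp [hA]

open Classical in
theorem card_not_isLinked_le {n τ h r : ℕ} {c : ℝ} (hn : 0 < n) (hc : 0 < c) (hc1 : c ≤ 1)
    (hτ : ∀ n w : ℕ, c / 64 * n ≤ w → (1 - c / 64) ^ (τ * w) ≤ (1 / 64 : ℝ) ^ n)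
    {H : Digraph (Fin n)} {d : ℝ} (hH : DepthRobust H (c * n) d) (hh : 0 < h)
    (hd : (2 * h : ℕ) ≤ d) (hr : (r * (2 * h) : ℝ) ≤ c / 2 * n) (hr' : c / 8 * n ≤ r * h)
    (hrn : r * r ≤ n) :
    ((Finset.univ.filter fun x : Samples n τ => ¬ IsLinked H (c / 2 * n) h r x).card : ℝ) ≤
      (1 / 2) ^ n * Fintype.card (Samples n τ) := by
  have hn' : (0 : ℝ) < n := by exact_mod_cast hn
  have hr0 : 0 < r := by
    rcases Nat.eq_zero_or_pos r with rfl | h0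
    · have : 0 < c / 8 * n := by positivity
      simp at hr'; linarith
    · exact h0
  -- The path systems are fixed for every `D` before the samples are considered, so the union bound
  -- ranges over `D`, the pair of layers and the set of pairs `R`, but not over systems of paths.
  -- For large `D` a dummy value is chosen.
  have hsys : ∀ (D : Finset (Fin 3 × Fin n)) (i : Fin 3),
      ∃ (A B : Fin r → Finset (Fin n)) (z : Fin r → Fin n), (D.card : ℝ) ≤ c / 2 * n →
        IsHalvesSystem H (slice D i) h r A B z := by
    intro D i
    by_cases hD : (D.card : ℝ) ≤ c / 2 * n
    · have h1 : ((slice D i).card : ℝ) ≤ D.card := by exact_mod_cast card_slice_le D i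
      obtain ⟨A, B, z, hABz⟩ := hH.exists_isHalvesSystem hh hd (slice D i) r (by linarith)
      exact ⟨A, B, z, fun _ => hABz⟩
    · exact ⟨fun _ => ∅, fun _ => ∅, fun _ => ⟨0, hn⟩, fun h => absurd h hD⟩
  choose A B z hABz using hsys
  set I : Finset (Finset (Fin 3 × Fin n) × Fin 2 × Finset (Fin r × Fin r)) :=
    Finset.univ.filter fun k => (k.1.card : ℝ) ≤ c / 2 * n ∧ r * r ≤ 4 * k.2.2.card with hI
  set F : Finset (Fin 3 × Fin n) × Fin 2 × Finset (Fin r × Fin r) → Fin 2 → Fin n →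
      Finset (Fin n) := fun k i v => if i = k.2.1 then Finset.univ.filter fun u =>
        ∃ p ∈ k.2.2, v ∈ A k.1 k.2.1.succ p.2 ∧ u ∈ B k.1 k.2.1.castSucc p.1 else ∅ with hF
  -- At least $r/8$ heavy columns, with left halves of size $h$, give $rh/8 \ge cn/64$ vertices;
  -- each must avoid $r/8$ right halves, again at least $cn/64$ vertices.
  have hcount : ∀ k ∈ I, ⌈c / 64 * n⌉₊ ≤
      (Finset.univ.filter fun v => c / 64 * n ≤ ((F k (k.2.1) v).card : ℝ)).card := by
    rintro ⟨D, s, R⟩ hk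
    rw [hI, Finset.mem_filter] at hk
    obtain ⟨-, hD, hR⟩ := hk
    dsimp only at hD hR ⊢
    have hJ := card_heavy_columns hr0 R hR
    set J := Finset.univ.filter fun j =>
      r ≤ 8 * (Finset.univ.filter fun i => (i, j) ∈ R).card with hJdef
    have hbig : ∀ m : ℕ, r ≤ 8 * m → c / 64 * n ≤ ((m * h : ℕ) : ℝ) := by
      intro m hm
      have h1 : (r : ℝ) ≤ 8 * m := by exact_mod_cast hm
      push_cast
      nlinarith [mul_le_mul_of_nonneg_right h1 (Nat.cast_nonneg h : (0 : ℝ) ≤ h)]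
    have hsub : J.biUnion (A D s.succ) ⊆
        Finset.univ.filter fun v => c / 64 * n ≤ ((F (D, s, R) s v).card : ℝ) := by
      intro v hv
      obtain ⟨j, hj, hvj⟩ := Finset.mem_biUnion.1 hv
      rw [Finset.mem_filter]
      refine ⟨Finset.mem_univ _, ?_⟩
      rw [hJdef, Finset.mem_filter] at hj
      refine (hbig _ hj.2).trans ?_
      rw [← card_biUnion_halves (fun j => ((hABz D s.castSucc hD).1 j).2)
        (hABz D s.castSucc hD).3]
      refine Nat.cast_le.2 (Finset.card_le_card fun u hu => ?_)
      obtain ⟨i, hi, hui⟩ := Finset.mem_biUnion.1 hu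
      simp only [hF, if_true, Finset.mem_filter, Finset.mem_univ, true_and]
      exact ⟨(i, j), by simpa using hi, hvj, hui⟩
    refine le_trans ?_ (Finset.card_le_card hsub)
    rw [card_biUnion_halves (fun j => ((hABz D s.succ hD).1 j).1) (hABz D s.succ hD).2]
    exact Nat.ceil_le.2 (hbig _ hJ)
  have h1 := card_samples_exists_avoiding_le (n := n) (τ := τ) (w := ⌈c / 64 * n⌉₊) (θ := c / 64)
    hn (by positivity) (by linarith) I F (fun k => k.2.1) hcount
  have hsub : (Finset.univ.filter fun x : Samples n τ => ¬ IsLinked H (c / 2 * n) h r x) ⊆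
      Finset.univ.filter fun x : Samples n τ => ∃ k ∈ I, ∀ i v t, x i v t ∉ F k i v := by
    intro x hx
    rw [Finset.mem_filter] at hx ⊢
    refine ⟨Finset.mem_univ _, ?_⟩
    have hx2 := hx.2
    unfold IsLinked at hx2
    push Not at hx2
    obtain ⟨D, hD, hx2⟩ := hx2
    obtain ⟨s, R, hR, hx3⟩ := hx2 (A D) (B D) (z D) fun i => hABz D i hD
    refine ⟨(D, s, R), by simp [hI, hD, hR], fun i v t => ?_⟩
    simp only [hF]
    split_ifs with his
    · rw [Finset.mem_filter]
      rintro ⟨-, p, hp, hv, hu⟩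
      rw [his] at hu
      exact hx3 p hp v hv t hu
    · simp
  refine (Nat.cast_le.2 (Finset.card_le_card hsub)).trans (h1.trans ?_)
  rw [← mul_assoc]
  refine mul_le_mul_of_nonneg_right ?_ (by positivity)
  have h3 := hτ n ⌈c / 64 * n⌉₊ (Nat.le_ceil _)
  -- There are $2^{3n}$ sets `D`, two pairs of layers, and $2^{r^2} \le 2^n$ sets `R`; the last
  -- bound is why the paths have to be long.
  have h4 : (I.card : ℝ) ≤ 2 * 16 ^ n := by
    have : I.card ≤ 2 * 16 ^ n := by
      refine (Finset.card_le_univ I).trans ?_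
      simp only [Fintype.card_prod, Fintype.card_finset, Fintype.card_fin]
      calc 2 ^ (3 * n) * (2 * 2 ^ (r * r)) ≤ 2 ^ (3 * n) * (2 * 2 ^ n) := by
            gcongr
            norm_num
        _ = 2 * 16 ^ n := by
            rw [show (16 : ℕ) = 2 ^ 4 by norm_num, ← pow_mul]; ring
    exact_mod_cast this
  calc (I.card : ℝ) * (1 - c / 64) ^ (τ * ⌈c / 64 * n⌉₊) ≤ 2 * 16 ^ n * (1 / 64) ^ n :=
        mul_le_mul h4 h3 (pow_nonneg (by linarith) _) (by positivity)
    _ = 2 * (1 / 2) ^ n * (1 / 2) ^ n := by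
        rw [mul_assoc, ← mul_pow, mul_assoc, ← mul_pow]; norm_num
    _ ≤ 1 * (1 / 2) ^ n := by
        refine mul_le_mul_of_nonneg_right ?_ (by positivity)
        have : (1 / 2 : ℝ) ^ n ≤ (1 / 2) ^ 1 :=
          pow_le_pow_of_le_one (by norm_num) (by norm_num) hn
        linarith
    _ = _ := one_mul _

theorem reach_threeLayer {n τ : ℕ} {H : Digraph (Fin n)} (x : Samples n τ)
    {D : Finset (Fin 3 × Fin n)} {i : Fin 3} {u v : Fin n}
    (h : Relation.ReflTransGen (DelAdj H (slice D i)) u v) :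
    Relation.ReflTransGen (DelAdj (threeLayer H x) D) (i, u) (i, v) :=
  h.lift (fun u => (i, u)) fun a b hab =>
    ⟨ThreeLayerAdj.layer i a b hab.1, by simpa [slice] using hab.2.1, by simpa [slice] using hab.2.2⟩

/-- A column with at most $r/2$ related entries has at least $r/2$ unrelated ones, so $r/2$ such
columns would account for $r^2/4$ unrelated pairs. -/
theorem card_filter_lt_of_relation {r : ℕ} (hr : 0 < r) (P : Fin r → Fin r → Prop)
    [∀ i j, Decidable (P i j)]
    (hP : 4 * (Finset.univ.filter fun p : Fin r × Fin r => ¬ P p.1 p.2).card < r * r) :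
    2 * (Finset.univ.filter fun j => 2 * (Finset.univ.filter fun i => P i j).card ≤ r).card < r := by
  set J := Finset.univ.filter fun j => 2 * (Finset.univ.filter fun i => P i j).card ≤ r with hJ
  have h1 : (Finset.univ.filter fun p : Fin r × Fin r => ¬ P p.1 p.2).card =
      ∑ j, (Finset.univ.filter fun i => ¬ P i j).card := by
    rw [Finset.card_eq_sum_card_fiberwise (f := Prod.snd) (t := Finset.univ) (by simp)]
    refine Finset.sum_congr rfl fun j _ => ?_
    refine Finset.card_bij' (fun p _ => p.1) (fun i _ => (i, j)) ?_ ?_ ?_ ?_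
    · rintro ⟨a, b⟩ h
      simp only [Finset.mem_filter, Finset.mem_univ, true_and] at h
      obtain ⟨h, rfl⟩ := h
      simpa using h
    · intro a h; simpa using h
    · rintro ⟨a, b⟩ h
      simp only [Finset.mem_filter] at h
      rw [h.2]
    · intros; rfl
  have h2 : J.card * r ≤ ∑ j : Fin r, 2 * (Finset.univ.filter fun i => ¬ P i j).card := by
    calc J.card * r = ∑ _j ∈ J, r := by simp
      _ ≤ ∑ j ∈ J, 2 * (Finset.univ.filter fun i => ¬ P i j).card := by
        refine Finset.sum_le_sum fun j hj => ?_
        rw [hJ, Finset.mem_filter] at hj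
        have := Finset.card_filter_add_card_filter_not (s := Finset.univ) (fun i => P i j)
        rw [Finset.card_univ, Fintype.card_fin] at this
        omega
      _ ≤ _ := Finset.sum_le_sum_of_subset (Finset.subset_univ _)
  rw [← Finset.mul_sum, ← h1] at h2
  nlinarith

/-- Fewer than half of the middle paths are linked with at most half of the paths below, and the
same holds above. So some middle path is good on both sides, and its cut vertex is the hub. -/
theorem IsLinked.exists_hub {n τ h r : ℕ} {H : Digraph (Fin n)} {e : ℝ} {x : Samples n τ}
    (hx : IsLinked H e h r x) (hh : 0 < h) (hr : 0 < r) (D : Finset (Fin 3 × Fin n))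
    (hD : (D.card : ℝ) ≤ e) :
    ∃ (z : Fin 3 × Fin n) (U U' : Finset (Fin n)), r * h < 2 * U.card ∧ r * h < 2 * U'.card ∧
      (∀ u ∈ U, (0, u) ∉ D ∧ Relation.ReflTransGen (DelAdj (threeLayer H x) D) (0, u) z) ∧
      ∀ u ∈ U', (2, u) ∉ D ∧ Relation.ReflTransGen (DelAdj (threeLayer H x) D) z (2, u) := by
  classical
  obtain ⟨A, B, z, hsys, hlink⟩ := hx D hD
  set P : Fin 2 → Fin r → Fin r → Prop := fun s i j =>
    ∃ v ∈ A s.succ j, ∃ t, x s v t ∈ B s.castSucc i with hP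
  have hcard : ∀ s, 4 * (Finset.univ.filter fun p : Fin r × Fin r => ¬ P s p.1 p.2).card <
      r * r := by
    intro s
    by_contra! hcon
    obtain ⟨p, hp, hp'⟩ := hlink s _ hcon
    rw [Finset.mem_filter] at hp
    exact hp.2 hp'
  have h0 := card_filter_lt_of_relation hr (P 0) (hcard 0)
  have h1 := card_filter_lt_of_relation hr (fun i j => P 1 j i) (by
    refine lt_of_eq_of_lt ?_ (hcard 1)
    congr 1
    refine Finset.card_bij' (fun p _ => p.swap) (fun p _ => p.swap) ?_ ?_ ?_ ?_ <;> simp)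
  obtain ⟨j, hj0, hj1⟩ : ∃ j, r < 2 * (Finset.univ.filter fun i => P 0 i j).card ∧
      r < 2 * (Finset.univ.filter fun i => P 1 j i).card := by
    by_contra! hcon
    have : (Finset.univ : Finset (Fin r)) ⊆
        (Finset.univ.filter fun j => 2 * (Finset.univ.filter fun i => P 0 i j).card ≤ r) ∪
        (Finset.univ.filter fun j => 2 * (Finset.univ.filter fun i => P 1 j i).card ≤ r) := by
      intro j _
      simp only [Finset.mem_union, Finset.mem_filter, Finset.mem_univ, true_and]
      by_contra! h
      exact absurd (hcon j h.1) (by omega)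
    have := (Finset.card_le_card this).trans (Finset.card_union_le _ _)
    rw [Finset.card_univ, Fintype.card_fin] at this
    omega
  -- From the lower cut vertex along the right half, over the sampled edge, and along the left half
  -- to the upper cut vertex.
  have hedge : ∀ (s : Fin 2) (i j : Fin r), P s i j →
      Relation.ReflTransGen (DelAdj (threeLayer H x) D)
        (s.castSucc, z s.castSucc i) (s.succ, z s.succ j) := by
    rintro s i j ⟨v, hv, t, ht⟩
    have e1 := reach_threeLayer x (((hsys s.castSucc).1 i).6 _ ht)
    have e2 := reach_threeLayer x (((hsys s.succ).1 j).5 _ hv)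
    have n1 := ((hsys s.castSucc).1 i).4 _ ht
    have n2 := ((hsys s.succ).1 j).3 _ hv
    exact (e1.tail ⟨ThreeLayerAdj.sampled s v t, by simpa [slice] using n1,
      by simpa [slice] using n2⟩).trans e2
  refine ⟨(1, z 1 j), (Finset.univ.filter fun i => P 0 i j).biUnion (A 0),
    (Finset.univ.filter fun i => P 1 j i).biUnion (B 2), ?_, ?_, ?_, ?_⟩
  · rw [card_biUnion_halves (fun j => ((hsys 0).1 j).1) (hsys 0).2]
    nlinarith
  · rw [card_biUnion_halves (fun j => ((hsys 2).1 j).2) (hsys 2).3]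
    nlinarith
  · intro u hu
    obtain ⟨i, hi, hui⟩ := Finset.mem_biUnion.1 hu
    rw [Finset.mem_filter] at hi
    exact ⟨by simpa [slice] using ((hsys 0).1 i).3 _ hui,
      (reach_threeLayer x (((hsys 0).1 i).5 _ hui)).trans (hedge 0 i j hi.2)⟩
  · intro u hu
    obtain ⟨i, hi, hui⟩ := Finset.mem_biUnion.1 hu
    rw [Finset.mem_filter] at hi
    exact ⟨by simpa [slice] using ((hsys 2).1 i).4 _ hui,
      (hedge 1 j i hi.2).trans (reach_threeLayer x (((hsys 2).1 i).6 _ hui))⟩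

/-- The deletion budget fits since $k \le cn/16 \le rh/2 < |U|, |U'|$. -/
theorem IsLinked.sTRobust {n τ h r : ℕ} {H : Digraph (Fin n)} {c : ℝ} {x : Samples n τ}
    (hc : 0 < c) (hn : 0 < n) (hx : IsLinked H (c / 2 * n) h r x) (hh : 0 < h) (hr : 0 < r)
    (hrh : c / 8 * n ≤ r * h)
    {A B : IODigraph n} (hA : IsSuperconcentrator A) (hB : IsSuperconcentrator B)
    {k : ℕ} (hk : (k : ℝ) ≤ c / 8 * n / 2) : STRobust (sandwich H A B x) k (n - k) := by
  intro (D : Finset (A.V ⊕ (Fin 3 × Fin n) ⊕ B.V)) hD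
  have hinj : Function.Injective
      (fun b : Fin 3 × Fin n => (Sum.inr (Sum.inl b) : A.V ⊕ (Fin 3 × Fin n) ⊕ B.V)) :=
    Sum.inr_injective.comp Sum.inl_injective
  set D' : Finset (Fin 3 × Fin n) :=
    Finset.preimage D _ hinj.injOn with hD'
  have hD'c : D'.card ≤ k :=
    (Finset.card_le_card_of_injOn _ (fun a ha => by simpa [hD'] using ha) hinj.injOn).trans hD
  have hn' : (0 : ℝ) < n := by exact_mod_cast hn
  have hcn : 0 < c * n := by positivity
  obtain ⟨z, U, U', hU, hU', hUz, hzU⟩ := hx.exists_hub hh hr D' (by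
    have : (D'.card : ℝ) ≤ k := by exact_mod_cast hD'c
    linarith)
  have hbig : ∀ m : ℕ, r * h < 2 * m → k < m := by
    intro m hm
    have : (r * h : ℝ) < 2 * m := by exact_mod_cast hm
    have : (k : ℝ) < m := by linarith
    exact_mod_cast this
  exact exists_hub_subgraph hA hB x D hD D' (fun v => by simp [hD']) z U U' (hbig _ hU)
    (hbig _ hU') hUz hzU


/-! ### Acyclicity, indegree and size of the sandwich -/

theorem isDAG_sandwich {n τ : ℕ} {H : Digraph (Fin n)} {A B : IODigraph n} (hH : IsDAG H)
    (hA : IsDAG A.graph) (hB : IsDAG B.graph) (x : Samples n τ) :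
    IsDAG (sandwich H A B x).graph := by
  -- A transitive relation containing all edges: lexicographic by part and layer, then reachability
  -- inside a single acyclic piece.
  let P : A.V ⊕ (Fin 3 × Fin n) ⊕ B.V → A.V ⊕ (Fin 3 × Fin n) ⊕ B.V → Prop := fun u v =>
    match u, v with
    | .inl a, .inl b => Relation.TransGen A.graph.Adj a b
    | .inl _, .inr _ => True
    | .inr _, .inl _ => False
    | .inr (.inl a), .inr (.inl b) => a.1 < b.1 ∨ a.1 = b.1 ∧ Relation.TransGen H.Adj a.2 b.2
    | .inr (.inl _), .inr (.inr _) => True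
    | .inr (.inr _), .inr (.inl _) => False
    | .inr (.inr a), .inr (.inr b) => Relation.TransGen B.graph.Adj a b
  have hadj : ∀ u v, SandwichAdj H A B x u v → P u v := by
    intro u v huv
    cases huv with
    | left u v h => exact .single h
    | enter => trivial
    | middle u v h =>
      cases h with
      | layer i u v h => exact Or.inr ⟨rfl, .single h⟩
      | sampled i v t => exact Or.inl (Fin.castSucc_lt_succ)
    | leave => trivial
    | right u v h => exact .single h
  have htrans : ∀ u v w, P u v → P v w → P u w := by
    rintro (u | u | u) (v | v | v) (w | w | w) h1 h2 <;> simp only [P] at h1 h2 ⊢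
    · exact h1.trans h2
    · rcases h1 with h1 | ⟨h1, h1'⟩ <;> rcases h2 with h2 | ⟨h2, h2'⟩
      · exact Or.inl (h1.trans h2)
      · exact Or.inl (h2 ▸ h1)
      · exact Or.inl (h1 ▸ h2)
      · exact Or.inr ⟨h1.trans h2, h1'.trans h2'⟩
    · exact h1.trans h2
  have hall : ∀ u v, Relation.TransGen (SandwichAdj H A B x) u v → P u v := by
    intro u v huv
    induction huv with
    | single h => exact hadj _ _ h
    | tail _ h ih => exact htrans _ _ _ ih (hadj _ _ h)
  rintro (v | v | v) hv
  · exact hA v (hall _ _ hv)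
  · rcases hall _ _ hv with h | h
    · exact lt_irrefl _ h
    · exact hH _ h.2
  · exact hB v (hall _ _ hv)

/-- A crude sum over the parts: a layer vertex has indegree at most $\delta_H + \tau + 1$, a vertex
of `B` at most $\delta_{SC} + 1$. -/
theorem indegreeLE_sandwich {n τ δH δSC : ℕ} {H : Digraph (Fin n)} {A B : IODigraph n}
    (hH : IndegreeLE H δH) (hA : IndegreeLE A.graph δSC) (hB : IndegreeLE B.graph δSC)
    (x : Samples n τ) : IndegreeLE (sandwich H A B x).graph (δH + δSC + τ + 1) := by
  rintro (v | ⟨i, v⟩ | v)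
  · have hsub : {u | (sandwich H A B x).graph.Adj u (Sum.inl v)} ⊆
        Sum.inl '' {u | A.graph.Adj u v} := by
      rintro u hu
      cases hu with
      | left u _ h => exact ⟨u, h, rfl⟩
    have := (Set.ncard_le_ncard hsub (Set.toFinite _)).trans
      ((Set.ncard_image_le (Set.toFinite _)).trans (hA v))
    omega
  · have hsub : {u | (sandwich H A B x).graph.Adj u (Sum.inr (Sum.inl (i, v)))} ⊆
        ((fun w : Fin n => (Sum.inr (Sum.inl (i, w)) : A.V ⊕ (Fin 3 × Fin n) ⊕ B.V)) ''
          {w | H.Adj w v} ∪ {u | ∃ s : Fin 2, s.succ = i ∧ u ∈ Set.range fun t : Fin τ =>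
            (Sum.inr (Sum.inl (s.castSucc, x s v t)) : A.V ⊕ (Fin 3 × Fin n) ⊕ B.V)}) ∪
        {Sum.inl (A.output v)} := by
      rintro u hu
      cases hu with
      | enter => exact Or.inr rfl
      | middle u _ h =>
        cases h with
        | layer _ u _ h => exact Or.inl (Or.inl ⟨u, h, rfl⟩)
        | sampled s _ t => exact Or.inl (Or.inr ⟨s, rfl, t, rfl⟩)
    have h1 : {u | ∃ s : Fin 2, s.succ = i ∧ u ∈ Set.range fun t : Fin τ =>
        (Sum.inr (Sum.inl (s.castSucc, x s v t)) : A.V ⊕ (Fin 3 × Fin n) ⊕ B.V)}.ncard ≤ τ := by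
      by_cases hs : ∃ s : Fin 2, s.succ = i
      · obtain ⟨s, hs⟩ := hs
        have h2 : {u | ∃ s : Fin 2, s.succ = i ∧ u ∈ Set.range fun t : Fin τ =>
            (Sum.inr (Sum.inl (s.castSucc, x s v t)) : A.V ⊕ (Fin 3 × Fin n) ⊕ B.V)} ⊆
            Set.range fun t : Fin τ => Sum.inr (Sum.inl (s.castSucc, x s v t)) := by
          rintro u ⟨s', hs', hu⟩
          rwa [Fin.succ_injective _ (hs'.trans hs.symm)] at hu
        refine (Set.ncard_le_ncard h2 (Set.toFinite _)).trans ?_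
        rw [← Set.image_univ]
        refine (Set.ncard_image_le (Set.toFinite _)).trans ?_
        simp [Set.ncard_univ]
      · have h2 : {u | ∃ s : Fin 2, s.succ = i ∧ u ∈ Set.range fun t : Fin τ =>
            (Sum.inr (Sum.inl (s.castSucc, x s v t)) : A.V ⊕ (Fin 3 × Fin n) ⊕ B.V)} = ∅ := by
          ext u
          simp only [Set.mem_ofPred_eq, Set.mem_empty_iff_false, iff_false]
          rintro ⟨s, h, -⟩
          exact hs ⟨s, h⟩
        rw [h2]; simp
    have := (Set.ncard_le_ncard hsub (Set.toFinite _)).trans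
      ((Set.ncard_union_le _ _).trans (Nat.add_le_add ((Set.ncard_union_le _ _).trans
        (Nat.add_le_add ((Set.ncard_image_le (Set.toFinite _)).trans (hH v)) h1))
          (Set.ncard_singleton _).le))
    omega
  · have hsub : {u | (sandwich H A B x).graph.Adj u (Sum.inr (Sum.inr v))} ⊆
        (fun w : B.V => (Sum.inr (Sum.inr w) : A.V ⊕ (Fin 3 × Fin n) ⊕ B.V)) ''
          {u | B.graph.Adj u v} ∪
        {u | ∃ j, B.input j = v ∧ u = Sum.inr (Sum.inl (2, j))} := by
      rintro u hu
      cases hu with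
      | right u _ h => exact Or.inl ⟨u, h, rfl⟩
      | leave j => exact Or.inr ⟨j, rfl, rfl⟩
    have h1 : {u : A.V ⊕ (Fin 3 × Fin n) ⊕ B.V |
        ∃ j, B.input j = v ∧ u = Sum.inr (Sum.inl (2, j))}.ncard ≤ 1 := by
      rw [Set.ncard_le_one_iff]
      rintro _ _ ⟨j, hj, rfl⟩ ⟨k, hk, rfl⟩
      rw [B.input.injective (hj.trans hk.symm)]
    have := (Set.ncard_le_ncard hsub (Set.toFinite _)).trans
      ((Set.ncard_union_le _ _).trans
        (Nat.add_le_add ((Set.ncard_image_le (Set.toFinite _)).trans (hB v)) h1))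
    omega

theorem card_sandwich {n τ : ℕ} (H : Digraph (Fin n)) (A B : IODigraph n) (x : Samples n τ) :
    Fintype.card (sandwich H A B x).V = Fintype.card A.V + (3 * n + Fintype.card B.V) := by
  have : Fintype.card (sandwich H A B x).V = Fintype.card (A.V ⊕ (Fin 3 × Fin n) ⊕ B.V) :=
    Fintype.card_congr (Equiv.refl _)
  rw [this]
  simp [Fintype.card_sum, Fintype.card_prod]

/-! ### Choice of parameters and the probability bound -/

/-- The parameters of the systems of halved paths. -/
theorem eventually_exists_params {c : ℝ} (hc : 0 < c) (hc1 : c ≤ 1) :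
    ∀ᶠ n : ℕ in Filter.atTop, ∃ h r : ℕ, 0 < h ∧ ((2 * h : ℕ) : ℝ) ≤ (n : ℝ) ^ (2 / 3 : ℝ) ∧
      (r * (2 * h) : ℝ) ≤ c / 2 * n ∧ c / 8 * n ≤ r * h ∧ r * r ≤ n := by
  obtain ⟨N, hN⟩ := exists_nat_ge (8 / c)
  filter_upwards [Filter.eventually_ge_atTop (N ^ 3), Filter.eventually_ge_atTop 64] with n hn hn2
  set y : ℝ := (n : ℝ) ^ (1 / 3 : ℝ) with hy
  have hn0 : (0 : ℝ) ≤ n := by positivity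
  have hy3 : y ^ 3 = n := by
    rw [hy, ← Real.rpow_natCast, ← Real.rpow_mul hn0]; norm_num
  have hy2 : y ^ 2 = (n : ℝ) ^ (2 / 3 : ℝ) := by
    rw [hy, ← Real.rpow_natCast, ← Real.rpow_mul hn0]; norm_num
  have hy0 : 0 ≤ y := Real.rpow_nonneg hn0 _
  have hyN : (N : ℝ) ≤ y := by
    refine le_of_pow_le_pow_left₀ (n := 3) (by norm_num) hy0 ?_
    rw [hy3]; exact_mod_cast hn
  have hy4 : 4 ≤ y := by
    refine le_of_pow_le_pow_left₀ (n := 3) (by norm_num) hy0 ?_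
    rw [hy3]; norm_num; exact_mod_cast hn2
  have hcy : 8 ≤ c * y := by
    rw [div_le_iff₀ hc] at hN
    nlinarith
  rw [← hy2, ← hy3]
  -- Half of $n^{2/3}$, rounded down; `r` below is then the largest number of paths with $rh \le
  -- cn/4$. Since $cy \ge 8$, rounding costs at most half of $cn/4$.
  set h := ⌊y ^ 2 / 2⌋₊ with hh
  have h1 : (h : ℝ) ≤ y ^ 2 / 2 := Nat.floor_le (by positivity)
  have h2 : y ^ 2 / 2 < h + 1 := Nat.lt_floor_add_one _
  have h3 : y ^ 2 / 4 ≤ h := by nlinarith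
  have hpos : (0 : ℝ) < h := by nlinarith
  set r := ⌊c / 4 * y ^ 3 / h⌋₊ with hr
  have r1 : (r : ℝ) ≤ c / 4 * y ^ 3 / h := Nat.floor_le (by positivity)
  have r2 : c / 4 * y ^ 3 / h < r + 1 := Nat.lt_floor_add_one _
  rw [le_div_iff₀ hpos] at r1
  rw [div_lt_iff₀ hpos] at r2
  have hy20 : 0 < y ^ 2 := by positivity
  refine ⟨h, r, by exact_mod_cast hpos, ?_, ?_, ?_, ?_⟩
  · push_cast; linarith
  · linarith
  · nlinarith [mul_le_mul_of_nonneg_right hcy hy20.le]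
  -- From $h \ge y^2/4$ follows $r \le cy \le n^{1/3}$, which is more than $r^2 \le n$ requires.
  · have h4 : (r : ℝ) * (y ^ 2 / 4) ≤ c / 4 * y ^ 3 :=
      (mul_le_mul_of_nonneg_left h3 (by positivity)).trans r1
    have h5 : (r : ℝ) ≤ y := by
      have : (r : ℝ) * y ^ 2 ≤ y * y ^ 2 := by nlinarith [pow_nonneg hy0 3]
      exact le_of_mul_le_mul_right this hy20
    have : (r * r : ℝ) ≤ n := by
      rw [← hy3]; nlinarith [mul_le_mul h5 h5 (by positivity) hy0]
    exact_mod_cast this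

theorem uniformOn_univ_real_ge {α : Type} [Fintype α] [Nonempty α] [MeasurableSpace α]
    [MeasurableSingletonClass α] (P : α → Prop)
    [DecidablePred P] {ε : ℝ}
    (h : ((Finset.univ.filter fun x => ¬ P x).card : ℝ) ≤ ε * Fintype.card α) :
    1 - ε ≤ (ProbabilityTheory.uniformOn (Set.univ : Set α)).real {x | P x} := by
  have hpos : (0 : ℝ) < Fintype.card α := by exact_mod_cast Fintype.card_pos
  have h1 : (ProbabilityTheory.uniformOn (Set.univ : Set α)).real {x | P x} =
      ((Finset.univ.filter P).card : ℝ) / Fintype.card α := by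
    rw [MeasureTheory.measureReal_def, ProbabilityTheory.uniformOn_univ]
    rw [show {x | P x} = ((Finset.univ.filter P : Finset α) : Set α) by ext; simp,
      MeasureTheory.Measure.count_apply_finset]
    simp
  rw [h1, le_div_iff₀ hpos]
  have h2 := Finset.card_filter_add_card_filter_not (s := Finset.univ) P
  rw [Finset.card_univ] at h2
  have h3 : ((Finset.univ.filter P).card : ℝ) + (Finset.univ.filter fun x => ¬ P x).card =
      Fintype.card α := by exact_mod_cast h2
  linarith

theorem DepthRobust.mono {V : Type} {G : Digraph V} {e e' d : ℝ} (h : e' ≤ e)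
    (hG : DepthRobust G e d) : DepthRobust G e' d := fun S hS => hG S (hS.trans h)

theorem sandwich_sTRobust (c : ℝ) (hc : 0 < c) : ∃ (c' : ℝ) (τ₀ : ℕ), 0 < c' ∧ ∀ τ : ℕ, τ₀ ≤ τ →
      ∀ (δH a δSC : ℕ) (H : ∀ n, Digraph (Fin n)) (A B : ∀ n, IODigraph n),
        IsDepthRobustFamily c δH H →
        IsSuperconcentratorFamily a δSC A →
        IsSuperconcentratorFamily a δSC B →
        ∀ᶠ n : ℕ in Filter.atTop,
          1 - (1 / 2 : ℝ) ^ n ≤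
            (ProbabilityTheory.uniformOn (Set.univ : Set (Samples n τ))).real
              {x | ∀ S : Finset (sandwich (H n) (A n) (B n) x).V, (S.card : ℝ) ≤ c' * n / 2 →
                STRobust (sandwich (H n) (A n) (B n) x) S.card (n - S.card)} := by
  classical
  -- Depth-robustness is monotone in the deletion budget, so `c` may be lowered to at most $1$. This
  -- makes $b/64$ a valid density and gives $r \le n^{1/3}$.
  set b := min c 1 with hb
  have hb0 : 0 < b := lt_min hc one_pos
  have hb1 : b ≤ 1 := min_le_right _ _
  obtain ⟨τ₀, hτ₀⟩ := exists_sampling_rate (θ := b / 64) (by positivity) (by linarith)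
  refine ⟨b / 8, τ₀, by positivity, fun τ hτ δH a δSC H A B hH hA hB => ?_⟩
  filter_upwards [eventually_exists_params hb0 hb1, Filter.eventually_ge_atTop 1] with n hn hn1
  obtain ⟨h, r, hh, hd, hr, hr', hrn⟩ := hn
  have hn' : (0 : ℝ) < n := by exact_mod_cast hn1
  have hr0 : 0 < r := by
    rcases Nat.eq_zero_or_pos r with rfl | h0
    · have : 0 < b / 8 * n := by positivity
      simp at hr'; linarith
    · exact h0
  have hrob : DepthRobust (H n) (b * n) ((n : ℝ) ^ (2 / 3 : ℝ)) :=
    ((hH n hn1).2.2).mono (mul_le_mul_of_nonneg_right (min_le_left _ _) hn'.le)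
  have key := card_not_isLinked_le (τ := τ) hn1 hb0 hb1 (hτ₀ τ hτ) hrob hh hd hr hr' hrn
  have : Nonempty (Fin n) := ⟨⟨0, hn1⟩⟩
  refine uniformOn_univ_real_ge _ (le_trans (Nat.cast_le.2 (Finset.card_le_card fun x hx => ?_)) key)
  rw [Finset.mem_filter] at hx ⊢
  exact ⟨hx.1, fun hl => hx.2 fun S hS =>
    hl.sTRobust hb0 hn1 hh hr0 hr' (hA n hn1).1 (hB n hn1).1 hS⟩


/-! ### Expanders and bounded concentrators by counting -/

theorem card_functions_into {n d N : ℕ} (S : Finset (Fin n)) (Y : Finset (Fin N)) :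
    (Finset.univ.filter fun f : Fin n → Fin d → Fin N => ∀ i ∈ S, ∀ t, f i t ∈ Y).card =
      Y.card ^ (d * S.card) * N ^ (d * (n - S.card)) := by
  classical
  have : (Finset.univ.filter fun f : Fin n → Fin d → Fin N => ∀ i ∈ S, ∀ t, f i t ∈ Y) =
      Fintype.piFinset fun i => Fintype.piFinset fun _ => if i ∈ S then Y else Finset.univ := by
    ext f
    simp only [Finset.mem_filter, Finset.mem_univ, true_and, Fintype.mem_piFinset]
    refine forall_congr' fun i => ?_
    by_cases h : i ∈ S <;> simp [h]
  rw [this]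
  simp only [Fintype.card_piFinset, Finset.prod_const, Finset.card_univ, Fintype.card_fin]
  rw [← Finset.prod_mul_prod_compl S]
  rw [Finset.prod_congr rfl (fun i hi => by rw [if_pos hi] : ∀ i ∈ S, _ = Y.card ^ d),
    Finset.prod_congr rfl (fun i hi => by
      rw [if_neg (Finset.mem_compl.1 hi)]; simp : ∀ i ∈ Sᶜ, _ = N ^ d)]
  simp [Finset.card_compl, pow_mul]

/-- Bounding $\binom mk$ by $(3m/k)^k$ leaves $18 (k/N)^{14}$ per factor, and $18 (3/4)^{14} < 1/2$.
The product bounds the probability that some $k$-set on the left sends all its $16k$ edges into some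
$k$-set on the right. -/
theorem choose_mul_choose_mul_pow_le {n N k : ℕ} (hk : 0 < k) (hnN : n ≤ 2 * N)
    (hkN : 4 * k ≤ 3 * N) :
    (n.choose k : ℝ) * N.choose k * (k / N : ℝ) ^ (16 * k) ≤ (1 / 2) ^ k := by
  have hk' : (0 : ℝ) < k := by exact_mod_cast hk
  have hN : (0 : ℝ) < N := by
    have : 0 < N := by omega
    exact_mod_cast this
  have hfac : (k : ℝ) ^ k / 3 ^ k ≤ k.factorial := by
    have h1 := Real.pow_div_factorial_le_exp (k : ℝ) hk'.le k
    have h2 : Real.exp k ≤ 3 ^ k := by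
      rw [← Real.exp_one_pow]
      exact pow_le_pow_left₀ (Real.exp_pos _).le Real.exp_one_lt_three.le _
    have h3 : (0 : ℝ) < k.factorial := by exact_mod_cast k.factorial_pos
    rw [div_le_iff₀ h3] at h1
    rw [div_le_iff₀ (by positivity)]
    nlinarith
  have hch : ∀ m : ℕ, (m.choose k : ℝ) ≤ (3 * m / k) ^ k := by
    intro m
    refine (Nat.choose_le_pow_div k m).trans ?_
    calc (m : ℝ) ^ k / k.factorial ≤ (m : ℝ) ^ k / ((k : ℝ) ^ k / 3 ^ k) :=
          div_le_div_of_nonneg_left (by positivity) (by positivity) hfac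
      _ = _ := by rw [div_pow, mul_pow]; field_simp
  have h1 : (n.choose k : ℝ) ≤ (6 * N / k) ^ k := by
    refine (hch n).trans (pow_le_pow_left₀ (by positivity) ?_ _)
    refine div_le_div_of_nonneg_right ?_ hk'.le
    have : (n : ℝ) ≤ 2 * N := by exact_mod_cast hnN
    linarith
  have hx : (k / N : ℝ) ≤ 3 / 4 := by
    rw [div_le_iff₀ hN]
    have : (4 * k : ℝ) ≤ 3 * N := by exact_mod_cast hkN
    linarith
  calc (n.choose k : ℝ) * N.choose k * (k / N : ℝ) ^ (16 * k)
      ≤ (6 * N / k) ^ k * (3 * N / k) ^ k * (k / N : ℝ) ^ (16 * k) := by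
        gcongr
        exact hch N
    _ = (18 * (k / N : ℝ) ^ 14) ^ k := by
        rw [pow_mul, ← mul_pow, ← mul_pow]
        congr 1
        field_simp
        norm_num
    _ ≤ _ := by
        refine pow_le_pow_left₀ (by positivity) ?_ _
        calc (18 * (k / N : ℝ) ^ 14) ≤ 18 * (3 / 4) ^ 14 := by gcongr
          _ ≤ _ := by norm_num

/-- Bipartite graphs of left degree 16 in which sets of at most half of the left vertices expand. -/
theorem exists_expanding_function {n N : ℕ} (hN : 2 * n ≤ 3 * N) (hn : n ≤ 2 * N) (hn0 : 0 < n) :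
    ∃ f : Fin n → Fin 16 → Fin N, ∀ S : Finset (Fin n), 2 * S.card ≤ n →
      S.card ≤ (S.biUnion fun i => Finset.univ.image (f i)).card := by
  classical
  by_contra! hcon
  have hN0 : 0 < N := by omega
  have hcover : (Finset.univ : Finset (Fin n → Fin 16 → Fin N)) ⊆
      (Finset.Icc 1 (n / 2)).biUnion fun k => (Finset.powersetCard k Finset.univ).biUnion fun S =>
        (Finset.powersetCard k Finset.univ).biUnion fun Y =>
          Finset.univ.filter fun f => ∀ i ∈ S, ∀ t, f i t ∈ Y := by
    intro f _
    obtain ⟨S, hS, hlt⟩ := hcon f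
    -- A neighbourhood with fewer than $k$ elements is enlarged to exactly $k$, so that one size `k`
    -- indexes both sets.
    obtain ⟨Y, hY, -, hYc⟩ := Finset.exists_subsuperset_card_eq
      (Finset.subset_univ (S.biUnion fun i => Finset.univ.image (f i))) hlt.le
      (by rw [Finset.card_univ, Fintype.card_fin]; omega)
    simp only [Finset.mem_biUnion, Finset.mem_Icc, Finset.mem_powersetCard, Finset.mem_filter,
      Finset.subset_univ, Finset.mem_univ, true_and]
    refine ⟨S.card, by omega, S, rfl, Y, hYc, fun i hi t => hY ?_⟩
    exact Finset.mem_biUnion.2 ⟨i, hi, Finset.mem_image_of_mem _ (Finset.mem_univ t)⟩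
  have h1 : (Finset.univ : Finset (Fin n → Fin 16 → Fin N)).card ≤ ∑ k ∈ Finset.Icc 1 (n / 2),
      n.choose k * (N.choose k * (k ^ (16 * k) * N ^ (16 * (n - k)))) := by
    refine (Finset.card_le_card hcover).trans (Finset.card_biUnion_le.trans ?_)
    refine Finset.sum_le_sum fun k _ => ?_
    have hc : ∀ m : ℕ, (Finset.powersetCard k (Finset.univ : Finset (Fin m))).card = m.choose k := by
      intro m; simp
    rw [← hc n]
    refine Finset.card_biUnion_le_card_mul _ _ _ fun S hS => ?_
    rw [← hc N]
    refine Finset.card_biUnion_le_card_mul _ _ _ fun Y hY => ?_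
    rw [card_functions_into, (Finset.mem_powersetCard.1 hS).2, (Finset.mem_powersetCard.1 hY).2]
  have h2 : ((N : ℝ) ^ 16) ^ n ≤ ∑ k ∈ Finset.Icc 1 (n / 2), (1 / 2 : ℝ) ^ k * ((N : ℝ) ^ 16) ^ n := by
    have h3 : (((N : ℝ) ^ 16) ^ n) ≤ ∑ k ∈ Finset.Icc 1 (n / 2),
        ((n.choose k : ℝ) * (N.choose k * (k ^ (16 * k) * N ^ (16 * (n - k))))) := by
      have := h1
      simp only [Finset.card_univ, Fintype.card_pi, Finset.prod_const, Fintype.card_fin] at this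
      exact_mod_cast this
    refine h3.trans (Finset.sum_le_sum fun k hk => ?_)
    rw [Finset.mem_Icc] at hk
    have hN' : (0 : ℝ) < N := by exact_mod_cast hN0
    have h4 := choose_mul_choose_mul_pow_le (n := n) (N := N) (k := k) (by omega) hn (by omega)
    have h5 : ((N : ℝ) ^ 16) ^ n = N ^ (16 * k) * N ^ (16 * (n - k)) := by
      rw [← pow_add, ← pow_mul]; congr 1; omega
    have h6 : (k / N : ℝ) ^ (16 * k) * N ^ (16 * k) = k ^ (16 * k) := by
      rw [← mul_pow, div_mul_cancel₀ _ hN'.ne']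
    calc (n.choose k : ℝ) * (N.choose k * (k ^ (16 * k) * N ^ (16 * (n - k))))
        = (n.choose k * N.choose k * (k / N : ℝ) ^ (16 * k)) *
          (N ^ (16 * k) * N ^ (16 * (n - k))) := by rw [← h6]; ring
      _ ≤ _ := by rw [h5]; exact mul_le_mul_of_nonneg_right h4 (by positivity)
  rw [← Finset.sum_mul] at h2
  have h3 : ∑ k ∈ Finset.Icc 1 (n / 2), (1 / 2 : ℝ) ^ k < 1 := by
    have : ∀ m : ℕ, ∑ k ∈ Finset.Icc 1 m, (1 / 2 : ℝ) ^ k = 1 - (1 / 2) ^ m := by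
      intro m
      induction m with
      | zero => simp
      | succ m ih => rw [Finset.sum_Icc_succ_top (by omega), ih]; ring
    rw [this]
    have : (0 : ℝ) < (1 / 2) ^ (n / 2) := by positivity
    linarith
  have h4 : (0 : ℝ) < ((N : ℝ) ^ 16) ^ n := by
    have hN' : (0 : ℝ) < N := by exact_mod_cast hN0
    positivity
  nlinarith

/-- A function can be refined so that its fibers have size at most `D`, with few new values. -/
theorem exists_refinement_small_fibers {m N D : ℕ} (hD : 0 < D) (f : Fin m → Fin N) :
    ∃ g : Fin m → Fin (N + m / D), (∀ a b, g a = g b → f a = f b) ∧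
      ∀ y, (Finset.univ.filter fun a => g a = y).card ≤ D := by
  classical
  -- The rank within the fiber of `f`. Fibers are cut into groups of `D` consecutive ranks.
  set rk : Fin m → ℕ := fun a => (Finset.univ.filter fun b => f b = f a ∧ b < a).card with hrk
  have hrklt : ∀ a b, f a = f b → a < b → rk a < rk b := by
    intro a b hab hlt
    refine Finset.card_lt_card (Finset.ssubset_iff_of_subset ?_ |>.2 ⟨a, ?_, ?_⟩)
    · intro x hx
      simp only [Finset.mem_filter, Finset.mem_univ, true_and] at hx ⊢
      exact ⟨hx.1.trans hab, hx.2.trans hlt⟩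
    · simp [hab, hlt]
    · simp
  have hrkinj : ∀ a b, f a = f b → rk a = rk b → a = b := by
    intro a b hab h
    rcases lt_trichotomy a b with hlt | rfl | hlt
    · exact absurd h (hrklt a b hab hlt).ne
    · rfl
    · exact absurd h (hrklt b a hab.symm hlt).ne'
  set g₀ : Fin m → Fin N × ℕ := fun a => (f a, rk a / D) with hg₀
  set T := Finset.univ.image g₀ with hT
  have hTc : T.card ≤ N + m / D := by
    have hsub : T ⊆ Finset.univ.biUnion fun r : Fin N => (Finset.range
        ((Finset.univ.filter fun b => f b = r).card / D + 1)).image fun q => (r, q) := by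
      intro p hp
      obtain ⟨a, -, rfl⟩ := Finset.mem_image.1 hp
      simp only [Finset.mem_biUnion, Finset.mem_univ, true_and, Finset.mem_image,
        Finset.mem_range, hg₀]
      refine ⟨f a, rk a / D, Nat.lt_succ_of_le (Nat.div_le_div_right (Finset.card_le_card ?_)), rfl⟩
      intro x hx
      simp only [Finset.mem_filter, Finset.mem_univ, true_and] at hx ⊢
      exact hx.1
    refine (Finset.card_le_card hsub).trans (Finset.card_biUnion_le.trans ?_)
    -- A fiber of size $s$ needs at most $\lfloor s/D \rfloor + 1$ groups; the first terms sum to at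
    -- most $m/D$, the ones to `N`.
    have h1 : ∑ r : Fin N, ((Finset.univ.filter fun b => f b = r).card / D) ≤ m / D := by
      rw [Nat.le_div_iff_mul_le hD, Finset.sum_mul]
      calc _ ≤ ∑ r : Fin N, (Finset.univ.filter fun b => f b = r).card :=
            Finset.sum_le_sum fun r _ => Nat.div_mul_le_self _ _
        _ = m := by
            rw [← Finset.card_eq_sum_card_fiberwise (by simp)]
            simp
    calc _ ≤ ∑ r : Fin N, ((Finset.univ.filter fun b => f b = r).card / D + 1) := by
          refine Finset.sum_le_sum fun r _ => Finset.card_image_le.trans ?_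
          simp
      _ ≤ _ := by
          rw [Finset.sum_add_distrib]
          simp only [Finset.sum_const, Finset.card_univ, Fintype.card_fin, smul_eq_mul]
          omega
  have hmem : ∀ a, g₀ a ∈ T := fun a => Finset.mem_image_of_mem _ (Finset.mem_univ a)
  set e : T → Fin (N + m / D) := fun p => Fin.castLE hTc (T.equivFin p) with he
  have heinj : Function.Injective e := (Fin.castLE_injective hTc).comp T.equivFin.injective
  have hg : ∀ a b, e ⟨g₀ a, hmem a⟩ = e ⟨g₀ b, hmem b⟩ → g₀ a = g₀ b := fun a b h =>
    congrArg Subtype.val (heinj h)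
  refine ⟨fun a => e ⟨g₀ a, hmem a⟩, fun a b h => congrArg Prod.fst (hg a b h), fun y => ?_⟩
  rcases (Finset.univ.filter fun a => e ⟨g₀ a, hmem a⟩ = y).eq_empty_or_nonempty with h0 | ⟨c, hc⟩
  · rw [h0]; simp
  · have hcy := (Finset.mem_filter.1 hc).2
    calc _ ≤ (Finset.Ico (rk c / D * D) (rk c / D * D + D)).card := by
          refine Finset.card_le_card_of_injOn rk ?_ ?_
          · intro a ha
            have hay := (Finset.mem_filter.1 ha).2
            have h2 : rk a / D = rk c / D := congrArg Prod.snd (hg a c (hay.trans hcy.symm))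
            rw [Finset.coe_Ico, Set.mem_Ico, ← h2]
            exact ⟨Nat.div_mul_le_self _ _, by
              have := Nat.lt_div_mul_add hD (a := rk a); omega⟩
          · intro a ha b hb hab
            have hay := (Finset.mem_filter.1 ha).2
            have hby := (Finset.mem_filter.1 hb).2
            exact hrkinj a b (congrArg Prod.fst (hg a b (hay.trans hby.symm))) hab
      _ = D := by simp

/-- Bounded concentrators. -/
theorem exists_concentrator {n : ℕ} (hn : 64 ≤ n) :
    ∃ Γ : Fin n → Finset (Fin (3 * n / 4)), (∀ i, (Γ i).card ≤ 16) ∧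
      (∀ r, (Finset.univ.filter fun i => r ∈ Γ i).card ≤ 256) ∧
      ∀ S : Finset (Fin n), 2 * S.card ≤ n → S.card ≤ (S.biUnion Γ).card := by
  classical
  -- About $2n/3$ right vertices, plus $16n/256 = n/16$ from splitting those of degree above $256$.
  -- As $2/3 + 1/16 < 3/4$, this fits for $n \ge 64$ despite rounding.
  obtain ⟨f, hf⟩ := exists_expanding_function (n := n) (N := (2 * n + 2) / 3) (by omega) (by omega)
    (by omega)
  obtain ⟨g, hg1, hg2⟩ := exists_refinement_small_fibers (m := n * 16) (D := 256) (by norm_num)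
    (fun a => f (finProdFinEquiv.symm a).1 (finProdFinEquiv.symm a).2)
  have hle : (2 * n + 2) / 3 + n * 16 / 256 ≤ 3 * n / 4 := by omega
  set G : Fin n → Fin 16 → Fin (3 * n / 4) := fun i t => Fin.castLE hle (g (finProdFinEquiv (i, t)))
    with hG
  refine ⟨fun i => Finset.univ.image (G i), fun i => ?_, fun r => ?_, fun S hS => ?_⟩
  · exact Finset.card_image_le.trans (by simp)
  · rcases (Finset.univ.filter fun i => r ∈ Finset.univ.image (G i)).eq_empty_or_nonempty with
      h0 | ⟨c, hc⟩
    · rw [h0]; simp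
    · simp only [Finset.mem_filter, Finset.mem_univ, true_and, Finset.mem_image] at hc
      obtain ⟨s, hs⟩ := hc
      refine le_trans ?_ (hg2 (g (finProdFinEquiv (c, s))))
      have hsub : (Finset.univ.filter fun i => r ∈ Finset.univ.image (G i)) ⊆
          (Finset.univ.filter fun a => g a = g (finProdFinEquiv (c, s))).image
            fun a => (finProdFinEquiv.symm a).1 := by
        intro i hi
        simp only [Finset.mem_filter, Finset.mem_univ, true_and, Finset.mem_image] at hi ⊢
        obtain ⟨t, ht⟩ := hi
        exact ⟨finProdFinEquiv (i, t), Fin.castLE_injective hle (ht.trans hs.symm), by simp⟩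
      exact (Finset.card_le_card hsub).trans Finset.card_image_le
  -- Splitting right vertices never merges them: one edge chosen for each old neighbour gives
  -- distinct new neighbours.
  · refine (hf S hS).trans ?_
    have hex : ∀ y ∈ S.biUnion (fun i => Finset.univ.image (f i)), ∃ i ∈ S, ∃ t, f i t = y := by
      intro y hy
      simpa using hy
    have : Nonempty (Fin n) := ⟨⟨0, by omega⟩⟩
    choose! a ha t ht using hex
    refine Finset.card_le_card_of_injOn (fun y => G (a y) (t y)) ?_ ?_
    · intro y hy
      simp only [Finset.coe_biUnion, Set.mem_iUnion, Finset.mem_coe]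
      exact ⟨a y, ha y hy, Finset.mem_image_of_mem _ (Finset.mem_univ _)⟩
    · intro y hy y' hy' h
      have := hg1 _ _ (Fin.castLE_injective hle h)
      simp only [Equiv.symm_apply_apply] at this
      rw [← ht y hy, ← ht y' hy', this]


/-! ### Recursive superconcentrators -/

/-- The edges of the network which joins `n` inputs to `n` outputs directly and through `A`. -/
inductive ConcentrateAdj {n m : ℕ} (Γ : Fin n → Finset (Fin m)) (A : IODigraph m) :
    Fin n ⊕ A.V ⊕ Fin n → Fin n ⊕ A.V ⊕ Fin n → Prop
  | direct (i : Fin n) : ConcentrateAdj Γ A (.inl i) (.inr (.inr i))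
  | enter (i : Fin n) (r : Fin m) : r ∈ Γ i →
      ConcentrateAdj Γ A (.inl i) (.inr (.inl (A.input r)))
  | inner (u v : A.V) : A.graph.Adj u v → ConcentrateAdj Γ A (.inr (.inl u)) (.inr (.inl v))
  | leave (j : Fin n) (r : Fin m) : r ∈ Γ j →
      ConcentrateAdj Γ A (.inr (.inl (A.output r))) (.inr (.inr j))

/-- The network which joins `n` inputs to `n` outputs directly and through `A`. -/
def concentrate {n m : ℕ} (Γ : Fin n → Finset (Fin m)) (A : IODigraph m) : IODigraph n where
  V := Fin n ⊕ A.V ⊕ Fin n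
  graph := ⟨ConcentrateAdj Γ A⟩
  input := Function.Embedding.inl
  output := Function.Embedding.inr.trans Function.Embedding.inr

/-- The graph of `concentrate Γ A`, with its vertex type spelled out. -/
abbrev concentrateGraph {n m : ℕ} (Γ : Fin n → Finset (Fin m)) (A : IODigraph m) :
    Digraph (Fin n ⊕ A.V ⊕ Fin n) :=
  ⟨ConcentrateAdj Γ A⟩

theorem isPathFromTo_pair {V : Type} {G : Digraph V} {u v : V} (h : G.Adj u v) (huv : u ≠ v) :
    IsPathFromTo G u v [u, v] :=
  ⟨⟨by simp, by simpa using h, by simpa using huv⟩, rfl, rfl⟩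

theorem isDAG_concentrate {n m : ℕ} (Γ : Fin n → Finset (Fin m)) {A : IODigraph m}
    (hA : IsDAG A.graph) : IsDAG (concentrate Γ A).graph := by
  let P : Fin n ⊕ A.V ⊕ Fin n → Fin n ⊕ A.V ⊕ Fin n → Prop := fun u v =>
    match u, v with
    | .inl _, .inl _ => False
    | .inl _, .inr _ => True
    | .inr _, .inl _ => False
    | .inr (.inl a), .inr (.inl b) => Relation.TransGen A.graph.Adj a b
    | .inr (.inl _), .inr (.inr _) => True
    | .inr (.inr _), .inr _ => False
  have hadj : ∀ u v, ConcentrateAdj Γ A u v → P u v := by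
    intro u v huv
    cases huv with
    | direct => trivial
    | enter => trivial
    | inner u v h => exact .single h
    | leave => trivial
  have htrans : ∀ u v w, P u v → P v w → P u w := by
    rintro (u | u | u) (v | v | v) (w | w | w) h1 h2 <;> simp only [P] at h1 h2 ⊢
    exact h1.trans h2
  have hall : ∀ u v, Relation.TransGen (ConcentrateAdj Γ A) u v → P u v := by
    intro u v huv
    induction huv with
    | single h => exact hadj _ _ h
    | tail _ h ih => exact htrans _ _ _ ih (hadj _ _ h)
  rintro (v | v | v) hv
  · exact hall _ _ hv
  · exact hA v (hall _ _ hv)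
  · exact hall _ _ hv

/-- That inputs of `A` have no incoming edges is what keeps the bound `d` from growing in the
recursion: such a vertex only receives the edges from `Γ`. -/
theorem indegreeLE_concentrate {n m d : ℕ} {Γ : Fin n → Finset (Fin m)} {A : IODigraph m}
    (hA : IndegreeLE A.graph d) (hin : ∀ u i, ¬ A.graph.Adj u (A.input i))
    (hΓ : ∀ i, (Γ i).card + 1 ≤ d)
    (hΓ' : ∀ r, (Finset.univ.filter fun i => r ∈ Γ i).card ≤ d) :
    IndegreeLE (concentrateGraph Γ A) d := by
  classical
  rintro (v | v | v)
  · have : {u | (concentrateGraph Γ A).Adj u (Sum.inl v)} = ∅ := by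
      ext u
      simp only [Set.mem_ofPred_eq, Set.mem_empty_iff_false, iff_false]
      intro h
      cases h
    rw [this]; simp
  · by_cases hv : ∃ r, A.input r = v
    · obtain ⟨r, rfl⟩ := hv
      have hsub : {u | (concentrateGraph Γ A).Adj u (Sum.inr (Sum.inl (A.input r)))} ⊆
          Sum.inl '' ((Finset.univ.filter fun i => r ∈ Γ i : Finset (Fin n)) : Set (Fin n)) := by
        intro u hu
        generalize hw : (Sum.inr (Sum.inl (A.input r)) : Fin n ⊕ A.V ⊕ Fin n) = w at hu
        cases hu with
        | enter i s h =>
          simp only [Sum.inr.injEq, Sum.inl.injEq, EmbeddingLike.apply_eq_iff_eq] at hw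
          subst hw
          exact ⟨i, by simpa using h, rfl⟩
        | inner a b h =>
          simp only [Sum.inr.injEq, Sum.inl.injEq] at hw
          subst hw
          exact absurd h (hin _ _)
        | direct => simp at hw
        | leave => simp at hw
      refine (Set.ncard_le_ncard hsub (Set.toFinite _)).trans
        ((Set.ncard_image_le (Set.toFinite _)).trans ?_)
      rw [Set.ncard_coe_finset]
      exact hΓ' r
    · have hsub : {u | (concentrateGraph Γ A).Adj u (Sum.inr (Sum.inl v))} ⊆
          (fun a : A.V => (Sum.inr (Sum.inl a) : Fin n ⊕ A.V ⊕ Fin n)) ''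
            {u | A.graph.Adj u v} := by
        intro u hu
        cases hu with
        | enter i r h => exact absurd ⟨r, rfl⟩ hv
        | inner u _ h => exact ⟨u, h, rfl⟩
      exact (Set.ncard_le_ncard hsub (Set.toFinite _)).trans
        ((Set.ncard_image_le (Set.toFinite _)).trans (hA v))
  · have hsub : {u | (concentrateGraph Γ A).Adj u (Sum.inr (Sum.inr v))} ⊆
        (fun r => (Sum.inr (Sum.inl (A.output r)) : Fin n ⊕ A.V ⊕ Fin n)) ''
          (Γ v : Set (Fin m)) ∪ {Sum.inl v} := by
      intro u hu
      cases hu with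
      | direct => exact Or.inr rfl
      | leave _ r h => exact Or.inl ⟨r, h, rfl⟩
    refine (Set.ncard_le_ncard hsub (Set.toFinite _)).trans ((Set.ncard_union_le _ _).trans ?_)
    have := Set.ncard_image_le (f := fun r => (Sum.inr (Sum.inl (A.output r)) : Fin n ⊕ A.V ⊕ Fin n))
      (Set.toFinite (Γ v : Set (Fin m)))
    rw [Set.ncard_coe_finset] at this
    rw [Set.ncard_singleton]
    have := hΓ v
    omega

/-- Hall's theorem: subsets of `X` also have at most $n/2$ elements, so their expansion is known. -/
theorem exists_matching {n m : ℕ} (hm : 0 < m) {Γ : Fin n → Finset (Fin m)}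
    (hΓ : ∀ S : Finset (Fin n), 2 * S.card ≤ n → S.card ≤ (S.biUnion Γ).card)
    (X : Finset (Fin n)) (hX : 2 * X.card ≤ n) :
    ∃ f : Fin n → Fin m, Set.InjOn f X ∧ ∀ i ∈ X, f i ∈ Γ i := by
  classical
  obtain ⟨f, hf, hfΓ⟩ := (Finset.all_card_le_biUnion_card_iff_exists_injective
    (fun i : X => Γ i)).1 (by
      intro S
      have h1 : (S.map (Function.Embedding.subtype _)).biUnion Γ = S.biUnion fun i : X => Γ i := by
        ext r
        simp
      rw [← h1, ← Finset.card_map (Function.Embedding.subtype (· ∈ X))]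
      refine hΓ _ (le_trans ?_ hX)
      refine Nat.mul_le_mul_left _ (Finset.card_le_card fun i hi => ?_)
      obtain ⟨j, -, rfl⟩ := Finset.mem_map.1 hi
      exact j.2)
  refine ⟨fun i => if h : i ∈ X then f ⟨i, h⟩ else ⟨0, hm⟩, ?_, ?_⟩
  · intro i hi j hj hij
    rw [Finset.mem_coe] at hi hj
    simp only [hi, hj, dif_pos] at hij
    exact congrArg Subtype.val (hf hij)
  · intro i hi
    simp only [hi, dif_pos]
    exact hfΓ ⟨i, hi⟩

theorem isPathFromTo_concentrate {n m : ℕ} {Γ : Fin n → Finset (Fin m)} {A : IODigraph m}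
    {i j : Fin n} {r s : Fin m} (hi : r ∈ Γ i) (hj : s ∈ Γ j) {p : List A.V}
    (hp : IsPathFromTo A.graph (A.input r) (A.output s) p) :
    IsPathFromTo (concentrateGraph Γ A) (Sum.inl i) (Sum.inr (Sum.inr j))
      (Sum.inl i :: (p.map fun v => (Sum.inr (Sum.inl v) : Fin n ⊕ A.V ⊕ Fin n)) ++
        [Sum.inr (Sum.inr j)]) := by
  obtain ⟨⟨hne, hchain, hnd⟩, hs, ht⟩ := hp
  have hinj : Function.Injective (fun v : A.V => (Sum.inr (Sum.inl v) : Fin n ⊕ A.V ⊕ Fin n)) :=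
    Sum.inr_injective.comp Sum.inl_injective
  refine ⟨⟨by simp, ?_, ?_⟩, by simp, by simp [List.getLast?_cons]⟩
  · rw [List.cons_append]
    rw [List.isChain_cons]
    refine ⟨?_, ?_⟩
    · intro y hy
      cases p with
      | nil => exact absurd rfl hne
      | cons a p =>
        simp only [List.head?_cons, Option.some.injEq] at hs
        simp only [List.map_cons, List.cons_append, List.head?_cons, Option.mem_def,
          Option.some.injEq] at hy
        subst hy hs
        exact ConcentrateAdj.enter i r hi
    · rw [List.isChain_append]
      refine ⟨?_, by simp, ?_⟩
      · rw [List.isChain_map]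
        exact hchain.imp fun a b hab => ConcentrateAdj.inner a b hab
      · intro x hx y hy
        simp only [List.head?_cons, Option.mem_def, Option.some.injEq] at hy
        subst hy
        rw [List.getLast?_map, ht] at hx
        simp only [Option.map_some, Option.mem_def, Option.some.injEq] at hx
        subst hx
        exact ConcentrateAdj.leave j s hj
  · simp only [List.cons_append, List.nodup_cons, List.mem_append, List.mem_map, List.mem_singleton]
    refine ⟨by simp, ?_⟩
    rw [List.nodup_append]
    refine ⟨hnd.map hinj, by simp, ?_⟩
    intro a ha b hb
    rw [List.mem_map] at ha
    obtain ⟨v, -, rfl⟩ := ha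
    rw [List.mem_singleton] at hb
    rw [hb]
    simp

/-- Indices in both `X` and `Y` use their direct edges. The disjoint sets `X \ Y` and `Y \ X` have
equal size, hence at most $n/2$ elements each; they are matched into the inputs and outputs of `A`,
which joins the matched vertices by disjoint paths. -/
theorem isSuperconcentrator_concentrate {n m : ℕ} (hm : 0 < m) {Γ : Fin n → Finset (Fin m)}
    {A : IODigraph m} (hA : IsSuperconcentrator A)
    (hΓ : ∀ S : Finset (Fin n), 2 * S.card ≤ n → S.card ≤ (S.biUnion Γ).card) :
    IsSuperconcentrator (concentrate Γ A) := by
  classical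
  refine ⟨isDAG_concentrate Γ hA.1, fun X Y hXY => ?_⟩
  have hXYc : (X \ Y).card = (Y \ X).card := by
    have h1 := Finset.card_sdiff_add_card_inter X Y
    have h2 := Finset.card_sdiff_add_card_inter Y X
    rw [Finset.inter_comm] at h2
    omega
  have hhalf : 2 * (X \ Y).card ≤ n := by
    have h1 : Disjoint (X \ Y) (Y \ X) := disjoint_sdiff_sdiff
    have h2 := Finset.card_le_univ (X \ Y ∪ Y \ X)
    rw [Finset.card_union_of_disjoint h1, Fintype.card_fin] at h2
    omega
  obtain ⟨a, ha, haΓ⟩ := exists_matching hm hΓ (X \ Y) hhalf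
  obtain ⟨b, hb, hbΓ⟩ := exists_matching hm hΓ (Y \ X) (by omega)
  obtain ⟨f, p, hf, hp, hdis⟩ := hA.2 ((X \ Y).image a) ((Y \ X).image b) (by
    rw [Finset.card_image_of_injOn ha, Finset.card_image_of_injOn hb, hXYc])
  have hmaps : ∀ i ∈ X \ Y, ∃ j ∈ Y \ X, b j = f (a i) := by
    intro i hi
    have : f (a i) ∈ (((Y \ X).image b : Finset (Fin m)) : Set (Fin m)) :=
      hf.mapsTo (by exact_mod_cast Finset.mem_image_of_mem a hi)
    simpa using this
  have hex : ∀ i, ∃ j, i ∈ X \ Y → j ∈ Y \ X ∧ b j = f (a i) := by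
    intro i
    by_cases hi : i ∈ X \ Y
    · obtain ⟨j, hj⟩ := hmaps i hi
      exact ⟨j, fun _ => hj⟩
    · exact ⟨i, fun h => absurd h hi⟩
  choose k hk using hex
  have haI : ∀ i ∈ X \ Y, a i ∈ (X \ Y).image a := fun i hi => Finset.mem_image_of_mem a hi
  have hkinj : ∀ i ∈ X \ Y, ∀ j ∈ X \ Y, k i = k j → i = j := by
    intro i hi j hj hij
    have h1 : f (a i) = f (a j) := by rw [← (hk i hi).2, ← (hk j hj).2, hij]
    exact ha hi hj (hf.injOn (by exact_mod_cast haI i hi) (by exact_mod_cast haI j hj) h1)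
  let pth : Fin n → List (Fin n ⊕ A.V ⊕ Fin n) := fun i =>
    if i ∈ Y then [Sum.inl i, Sum.inr (Sum.inr i)] else
      Sum.inl i :: ((p (a i)).map fun v => (Sum.inr (Sum.inl v) : Fin n ⊕ A.V ⊕ Fin n)) ++
        [Sum.inr (Sum.inr (k i))]
  have hg : ∀ i ∈ X, ∀ j ∈ X, (if i ∈ Y then i else k i) = (if j ∈ Y then j else k j) → i = j := by
    intro i hi j hj hij
    have hsd : ∀ i ∈ X, i ∉ Y → i ∈ X \ Y := fun i h1 h2 => Finset.mem_sdiff.2 ⟨h1, h2⟩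
    split_ifs at hij with h1 h2 h2
    · exact hij
    · have := (hk j (hsd j hj h2)).1
      rw [← hij] at this
      exact absurd hi (Finset.mem_sdiff.1 this).2
    · have := (hk i (hsd i hi h1)).1
      rw [hij] at this
      exact absurd hj (Finset.mem_sdiff.1 this).2
    · exact hkinj i (hsd i hi h1) j (hsd j hj h2) hij
  have hgm : ∀ i ∈ X, (if i ∈ Y then i else k i) ∈ Y := by
    intro i hi
    split_ifs with h
    · exact h
    · exact (Finset.mem_sdiff.1 (hk i (Finset.mem_sdiff.2 ⟨hi, h⟩)).1).1
  refine ⟨fun i => if i ∈ Y then i else k i, pth, ⟨?_, ?_, ?_⟩, ?_, ?_⟩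
  · intro i hi
    exact_mod_cast hgm i hi
  · intro i hi j hj hij
    exact hg i hi j hj hij
  · exact Finset.surjOn_of_injOn_of_card_le _ (fun i hi => by exact_mod_cast hgm i hi)
      (fun i hi j hj hij => hg i hi j hj hij) hXY.ge
  · intro i hi
    by_cases hiY : i ∈ Y
    · simp only [pth, hiY, if_true]
      exact isPathFromTo_pair (G := concentrateGraph Γ A) (ConcentrateAdj.direct i)
        Sum.inl_ne_inr
    · simp only [pth, hiY, if_false]
      have hi' : i ∈ X \ Y := Finset.mem_sdiff.2 ⟨hi, hiY⟩
      have h1 := hp (a i) (haI i hi')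
      rw [← (hk i hi').2] at h1
      exact isPathFromTo_concentrate (haΓ i hi') (hbΓ _ (hk i hi').1) h1
  · intro i hi j hj hij
    have hgij : (if i ∈ Y then i else k i) ≠ (if j ∈ Y then j else k j) :=
      fun h => hij (hg i hi j hj h)
    have hmem : ∀ i v, v ∈ pth i → v = Sum.inl i ∨
        v = Sum.inr (Sum.inr (if i ∈ Y then i else k i)) ∨
        (i ∉ Y ∧ ∃ w ∈ p (a i), v = Sum.inr (Sum.inl w)) := by
      intro i v hv
      by_cases hiY : i ∈ Y
      · simp only [pth, hiY, if_true, List.mem_cons, List.not_mem_nil, or_false] at hv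
        simp only [hiY, if_true]
        tauto
      · simp only [pth, hiY, if_false, List.mem_cons, List.cons_append, List.mem_append,
          List.mem_map, List.not_mem_nil, or_false] at hv
        simp only [hiY, if_false]
        rcases hv with hv | ⟨w, hw, rfl⟩ | hv
        · exact Or.inl hv
        · exact Or.inr (Or.inr ⟨not_false, w, hw, rfl⟩)
        · exact Or.inr (Or.inl hv)
    intro v hvi hvj
    rcases hmem i v hvi with rfl | rfl | ⟨hiY, w, hw, rfl⟩ <;>
      rcases hmem j _ hvj with h | h | ⟨hjY, w', hw', h⟩ <;>
      simp only [Sum.inl.injEq, Sum.inr.injEq, reduceCtorEq] at h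
    · exact hij h
    · exact hgij h
    · subst h
      have hi' : i ∈ X \ Y := Finset.mem_sdiff.2 ⟨hi, hiY⟩
      have hj' : j ∈ X \ Y := Finset.mem_sdiff.2 ⟨hj, hjY⟩
      exact hdis _ (haI i hi') _ (haI j hj') (fun h => hij (ha hi' hj' h)) hw hw'

/-- The complete bipartite network. -/
def completeNetwork (n : ℕ) : IODigraph n where
  V := Fin n ⊕ Fin n
  graph := ⟨fun u v => u.isLeft ∧ v.isRight⟩
  input := Function.Embedding.inl
  output := Function.Embedding.inr

theorem isSuperconcentrator_completeNetwork (n : ℕ) :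
    IsSuperconcentrator (completeNetwork n) := by
  constructor
  · intro v hv
    have : ∀ u v, Relation.TransGen (completeNetwork n).graph.Adj u v →
        Sum.isLeft (α := Fin n) (β := Fin n) u ∧ Sum.isRight (α := Fin n) (β := Fin n) v := by
      intro u v h
      induction h with
      | single h => exact h
      | tail _ h ih => exact ⟨ih.1, h.2⟩
    have h := this v v hv
    rcases v with v | v <;> simp at h
  · intro X Y hXY
    obtain ⟨f, hf⟩ : ∃ f : Fin n → Fin n, Set.BijOn f X Y := by
      have e := Finset.equivOfCardEq hXY
      classical
      refine ⟨fun i => if h : i ∈ X then e ⟨i, h⟩ else i, ?_, ?_, ?_⟩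
      · intro i hi
        rw [Finset.mem_coe] at hi
        simp [hi]
      · intro i hi j hj hij
        rw [Finset.mem_coe] at hi hj
        simp only [hi, hj, dif_pos] at hij
        exact congrArg Subtype.val (e.injective (Subtype.ext hij))
      · intro j hj
        refine ⟨e.symm ⟨j, hj⟩, (e.symm ⟨j, hj⟩).2, ?_⟩
        simp
    refine ⟨f, fun i => [Sum.inl i, Sum.inr (f i)], hf, fun i _ => ?_, fun i hi j hj hij => ?_⟩
    · exact isPathFromTo_pair (G := (⟨fun u v => u.isLeft ∧ v.isRight⟩ : Digraph (Fin n ⊕ Fin n)))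
        ⟨rfl, rfl⟩ Sum.inl_ne_inr
    · have hfij : f i ≠ f j := fun h => hij (hf.injOn hi hj h)
      have hmem : ∀ i v, v ∈ [(Sum.inl i : Fin n ⊕ Fin n), Sum.inr (f i)] →
          v = Sum.inl i ∨ v = Sum.inr (f i) := fun i v hv => by simpa using hv
      intro v hvi hvj
      rcases hmem i v hvi with rfl | rfl <;> rcases hmem j _ hvj with h | h <;> simp at h
      · exact hij h
      · exact hfij h

/-- The size recursion closes because $2n + 8 \cdot 3n/4 = 8n$. Below $64$ the complete bipartite
network already has small indegree. The last clause is carried along for `indegreeLE_concentrate`.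
-/
theorem exists_superconcentrator (n : ℕ) : ∃ A : IODigraph n, IsSuperconcentrator A ∧
    Fintype.card A.V ≤ 8 * n ∧ IndegreeLE A.graph 256 ∧ ∀ u i, ¬ A.graph.Adj u (A.input i) := by
  induction n using Nat.strong_induction_on with
  | _ n ih =>
    rcases lt_or_ge n 64 with hn | hn
    · refine ⟨completeNetwork n, isSuperconcentrator_completeNetwork n, ?_, ?_, ?_⟩
      · have : Fintype.card (completeNetwork n).V = Fintype.card (Fin n ⊕ Fin n) :=
          Fintype.card_congr (Equiv.refl _)
        rw [this]; simp; omega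
      · intro v
        have h1 := Set.ncard_le_ncard (Set.subset_univ {u | (completeNetwork n).graph.Adj u v})
          (Set.toFinite _)
        have : Nat.card (completeNetwork n).V = Nat.card (Fin n ⊕ Fin n) := rfl
        rw [Set.ncard_univ, this] at h1
        simp at h1
        omega
      · intro u i h
        have : Sum.isRight (Sum.inl i : Fin n ⊕ Fin n) = true := h.2
        simp at this
    · obtain ⟨A, hA, hAc, hAd, hAi⟩ := ih (3 * n / 4) (by omega)
      obtain ⟨Γ, hΓ1, hΓ2, hΓ3⟩ := exists_concentrator hn
      refine ⟨concentrate Γ A, isSuperconcentrator_concentrate (by omega) hA hΓ3, ?_,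
        indegreeLE_concentrate hAd hAi (fun i => by have := hΓ1 i; omega) hΓ2, ?_⟩
      · have : Fintype.card (concentrate Γ A).V = Fintype.card (Fin n ⊕ A.V ⊕ Fin n) :=
          Fintype.card_congr (Equiv.refl _)
        rw [this]; simp; omega
      · intro u i h
        change ConcentrateAdj Γ A u (Sum.inl i) at h
        cases h

theorem exists_isSuperconcentratorFamily :
    ∃ (a δ : ℕ) (A : ∀ n, IODigraph n), IsSuperconcentratorFamily a δ A := by
  choose A hA using exists_superconcentrator
  exact ⟨8, 256, A, fun n _ => ⟨(hA n).1, (hA n).2.1, (hA n).2.2.1⟩⟩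


/-! ### Levels of blocks and separating thresholds -/

open Classical in
/-- The level of a block: nearly all of its undeleted outgoing ports have at least this label, and
nearly all of its undeleted incoming ports have a smaller one. -/
theorem exists_block_level {K d : ℕ} {ε : ℝ} (hK : 0 < K) (hε : 0 < ε) (hε2 : 2 * ε < 1)
    {E : ℕ → Finset ℕ}
    (hE : ∀ X Y : Finset ℕ, X ⊆ Finset.range K → Y ⊆ Finset.range K →
      ε * K ≤ X.card → ε * K ≤ Y.card → ∃ y ∈ Y, ∃ x ∈ X, x ∈ E y)
    (p q : ℕ → Prop) (f g : ℕ → ℕ)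
    (hp : (((Finset.range K).filter p).card : ℝ) ≤ ε * K)
    (hq : (((Finset.range K).filter q).card : ℝ) ≤ ε * K)
    (hfg : ∀ j < K, ∀ i < K, j ∈ E i → ¬ p j → ¬ q i → f j < g i)
    (hd : ∀ i < K, ¬ q i → g i < d) :
    ∃ L < d, (((Finset.range K).filter fun i => p i ∨ L ≤ f i).card : ℝ) ≤ 2 * ε * K ∧
      (((Finset.range K).filter fun i => q i ∨ g i < L).card : ℝ) ≤ 2 * ε * K := by
  have hK' : (0 : ℝ) < K := by exact_mod_cast hK
  set Q : ℕ → Prop := fun L =>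
    (((Finset.range K).filter fun i => q i ∨ g i < L).card : ℝ) ≤ 2 * ε * K with hQ
  have hεK : 0 < ε * K := by positivity
  have hQ0 : Q 0 := by
    simp only [hQ, not_lt_zero, or_false]
    linarith
  have hQd : ¬ Q d := by
    simp only [hQ, not_le]
    have : ((Finset.range K).filter fun i => q i ∨ g i < d) = Finset.range K := by
      rw [Finset.filter_eq_self]
      intro i hi
      by_cases h : q i
      · exact Or.inl h
      · exact Or.inr (hd i (Finset.mem_range.1 hi) h)
    rw [this, Finset.card_range]
    nlinarith
  -- The largest level that nearly all outgoing ports attain. It is below `d` because undeleted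
  -- labels are below `d` and $2\varepsilon < 1$.
  set L := Nat.findGreatest Q d with hL
  have hQL : Q L := Nat.findGreatest_spec (Nat.zero_le d) hQ0
  have hLd : L < d := lt_of_le_of_ne (Nat.findGreatest_le d) fun h => hQd (h ▸ hQL)
  have hQL1 : ¬ Q (L + 1) := Nat.findGreatest_is_greatest (Nat.lt_succ_self _) hLd
  refine ⟨L, hLd, ?_, hQL⟩
  set X := (Finset.range K).filter fun j => ¬ p j ∧ L ≤ f j with hX
  -- If many incoming ports had labels at least `L`, then by mixing all but few outgoing ports would
  -- receive an edge from one of them and so have label at least `L + 1`, against maximality.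
  have hXc : (X.card : ℝ) < ε * K := by
    by_contra! hXc
    refine hQL1 ?_
    set Y := (Finset.range K).filter fun i => ∀ j ∈ X, j ∉ E i with hY
    have hYc : (Y.card : ℝ) < ε * K := by
      by_contra! hYc
      obtain ⟨y, hy, x, hx, hxy⟩ := hE X Y (Finset.filter_subset _ _) (Finset.filter_subset _ _)
        hXc hYc
      exact (Finset.mem_filter.1 hy).2 x hx hxy
    have hsub : ((Finset.range K).filter fun i => q i ∨ g i < L + 1) ⊆
        (Finset.range K).filter q ∪ Y := by
      intro i hi
      obtain ⟨hiK, hi⟩ := Finset.mem_filter.1 hi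
      rw [Finset.mem_union]
      by_cases hqi : q i
      · exact Or.inl (Finset.mem_filter.2 ⟨hiK, hqi⟩)
      · refine Or.inr (Finset.mem_filter.2 ⟨hiK, fun j hj hji => ?_⟩)
        obtain ⟨hjK, hpj, hj⟩ := Finset.mem_filter.1 hj
        have := hfg j (Finset.mem_range.1 hjK) i (Finset.mem_range.1 hiK) hji hpj hqi
        have := hi.resolve_left hqi
        omega
    have h1 : (((Finset.range K).filter fun i => q i ∨ g i < L + 1).card : ℝ) ≤
        ((Finset.range K).filter q).card + Y.card := by
      exact_mod_cast (Finset.card_le_card hsub).trans (Finset.card_union_le _ _)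
    change (((Finset.range K).filter fun i => q i ∨ g i < L + 1).card : ℝ) ≤ 2 * ε * K
    linarith
  have hsub : ((Finset.range K).filter fun i => p i ∨ L ≤ f i) ⊆ (Finset.range K).filter p ∪ X := by
    intro i hi
    obtain ⟨hiK, hi⟩ := Finset.mem_filter.1 hi
    rw [Finset.mem_union]
    by_cases hpi : p i
    · exact Or.inl (Finset.mem_filter.2 ⟨hiK, hpi⟩)
    · exact Or.inr (Finset.mem_filter.2 ⟨hiK, hpi, hi.resolve_left hpi⟩)
  have h1 : (((Finset.range K).filter fun i => p i ∨ L ≤ f i).card : ℝ) ≤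
      ((Finset.range K).filter p).card + X.card := by
    exact_mod_cast (Finset.card_le_card hsub).trans (Finset.card_union_le _ _)
  linarith

open Classical in
/-- A threshold which nearly separates the levels of the left half from those of the right half. -/
theorem exists_separating_threshold {N : ℕ} {ε : ℝ} (hN : 0 < N) (hε : 0 < ε) {E : ℕ → Finset ℕ}
    (hE : ∀ X Y : Finset ℕ, X ⊆ Finset.range N → Y ⊆ Finset.range N →
      ε * N ≤ X.card → ε * N ≤ Y.card → ∃ y ∈ Y, ∃ x ∈ X, x ∈ E y)
    (p q : ℕ → Prop) (f g : ℕ → ℕ)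
    (hfg : ∀ x < N, ∀ y < N, x ∈ E y → ¬ p x → ¬ q y → f x < g y) :
    ∃ t, (((Finset.range N).filter fun x => t ≤ f x).card : ℝ) ≤
        ε * N + ((Finset.range N).filter p).card ∧
      (((Finset.range N).filter fun y => g y < t).card : ℝ) ≤
        ε * N + ((Finset.range N).filter q).card := by
  have hN' : (0 : ℝ) < N := by exact_mod_cast hN
  have hεN : 0 < ε * N := by positivity
  set Q : ℕ → Prop := fun t =>
    (((Finset.range N).filter fun x => ¬ p x ∧ t ≤ f x).card : ℝ) < ε * N with hQ
  have hex : ∃ t, Q t := by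
    refine ⟨(Finset.range N).sup f + 1, ?_⟩
    have : ((Finset.range N).filter fun x => ¬ p x ∧ (Finset.range N).sup f + 1 ≤ f x) = ∅ := by
      rw [Finset.filter_eq_empty_iff]
      rintro x hx ⟨-, h⟩
      have := Finset.le_sup (f := f) hx
      omega
    simp only [hQ, this, Finset.card_empty, Nat.cast_zero]
    exact hεN
  -- The least threshold that few unexcluded left labels attain. By minimality many attain `t - 1`,
  -- so an edge into a large set of right labels below `t` would need a label strictly between `t -
  -- 1` and `t`.
  set t := Nat.find hex with ht
  have hQt : Q t := Nat.find_spec hex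
  refine ⟨t, ?_, ?_⟩
  · have hsub : ((Finset.range N).filter fun x => t ≤ f x) ⊆
        ((Finset.range N).filter fun x => ¬ p x ∧ t ≤ f x) ∪ (Finset.range N).filter p := by
      intro x hx
      obtain ⟨hxN, hx⟩ := Finset.mem_filter.1 hx
      rw [Finset.mem_union]
      by_cases hpx : p x
      · exact Or.inr (Finset.mem_filter.2 ⟨hxN, hpx⟩)
      · exact Or.inl (Finset.mem_filter.2 ⟨hxN, hpx, hx⟩)
    have h1 : (((Finset.range N).filter fun x => t ≤ f x).card : ℝ) ≤
        ((Finset.range N).filter fun x => ¬ p x ∧ t ≤ f x).card +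
          ((Finset.range N).filter p).card := by
      exact_mod_cast (Finset.card_le_card hsub).trans (Finset.card_union_le _ _)
    have : (((Finset.range N).filter fun x => ¬ p x ∧ t ≤ f x).card : ℝ) < ε * N := hQt
    linarith
  · set Y := (Finset.range N).filter fun y => ¬ q y ∧ g y < t with hY
    have hYc : (Y.card : ℝ) ≤ ε * N := by
      by_contra! hYc
      rcases Nat.eq_zero_or_pos t with h0 | hpos
      · rw [hY, h0] at hYc
        simp at hYc
        linarith
      · have hQ' : ¬ Q (t - 1) := Nat.find_min hex (by omega)
        simp only [hQ, not_lt] at hQ'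
        obtain ⟨y, hy, x, hx, hxy⟩ := hE _ Y (Finset.filter_subset _ _) (Finset.filter_subset _ _)
          hQ' hYc.le
        obtain ⟨hyN, hqy, hy⟩ := Finset.mem_filter.1 hy
        obtain ⟨hxN, hpx, hx⟩ := Finset.mem_filter.1 hx
        have := hfg x (Finset.mem_range.1 hxN) y (Finset.mem_range.1 hyN) hxy hpx hqy
        omega
    have hsub : ((Finset.range N).filter fun y => g y < t) ⊆ Y ∪ (Finset.range N).filter q := by
      intro y hy
      obtain ⟨hyN, hy⟩ := Finset.mem_filter.1 hy
      rw [Finset.mem_union]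
      by_cases hqy : q y
      · exact Or.inr (Finset.mem_filter.2 ⟨hyN, hqy⟩)
      · exact Or.inl (Finset.mem_filter.2 ⟨hyN, hqy, hy⟩)
    have h1 : (((Finset.range N).filter fun y => g y < t).card : ℝ) ≤
        Y.card + ((Finset.range N).filter q).card := by
      exact_mod_cast (Finset.card_le_card hsub).trans (Finset.card_union_le _ _)
    linarith

/-! ### Counting misplaced leaves of the binary tree -/

/-- The leaf `B` of the binary tree is on the wrong side at level `i`, where the leaves with labels
less than `t i I` should be on the left below the node `I`, and the other ones on the right. -/
def Misplaced (t : ℕ → ℕ → ℕ) (l i B : ℕ) : Prop :=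
  if B / 2 ^ i % 2 = 1 then l < t i (B / 2 ^ (i + 1)) else t i (B / 2 ^ (i + 1)) ≤ l

-- For a fixed label, the set of levels at which a leaf is misplaced determines the leaf: going down
-- from the root, the current node and the error bit tell which child comes next. So the sum is at
-- most $\sum_T s^{|T|}$ over subsets $T$ of the $K$ levels.
open Classical in
theorem sum_pow_card_misplaced_le (t : ℕ → ℕ → ℕ) (l K : ℕ) {s : ℝ} (hs : 0 ≤ s) :
    ∑ B ∈ Finset.range (2 ^ K), s ^ ((Finset.range K).filter fun i => Misplaced t l i B).card ≤
      (1 + s) ^ K := by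
  set C : ℕ → Finset ℕ := fun B => (Finset.range K).filter fun i => Misplaced t l i B with hC
  have hinj : Set.InjOn C (Finset.range (2 ^ K) : Set ℕ) := by
    intro B hB B' hB' hBB
    rw [Finset.mem_coe, Finset.mem_range] at hB hB'
    have key : ∀ j, j ≤ K → B / 2 ^ (K - j) = B' / 2 ^ (K - j) := by
      intro j
      induction j with
      | zero => intro _; simp [Nat.div_eq_of_lt hB, Nat.div_eq_of_lt hB']
      | succ j ih =>
        intro hj
        have h1 := ih (by omega)
        obtain ⟨i, hi⟩ : ∃ i, i = K - (j + 1) := ⟨_, rfl⟩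
        have hi' : K - j = i + 1 := by omega
        rw [← hi]
        rw [hi'] at h1
        have h2 : (Misplaced t l i B) ↔ Misplaced t l i B' := by
          have hiK : i < K := by omega
          have : i ∈ C B ↔ i ∈ C B' := by rw [hBB]
          simpa [hC, hiK] using this
        unfold Misplaced at h2
        rw [h1] at h2
        have e1 : B / 2 ^ i / 2 = B' / 2 ^ i / 2 := by
          rw [Nat.div_div_eq_div_mul, Nat.div_div_eq_div_mul, ← pow_succ, h1]
        split_ifs at h2 with h3 h4 h4 <;> omega
    have := key K le_rfl
    simpa using this
  calc ∑ B ∈ Finset.range (2 ^ K), s ^ (C B).card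
      = ∑ T ∈ (Finset.range (2 ^ K)).image C, s ^ T.card := by
        rw [Finset.sum_image hinj]
    _ ≤ ∑ T ∈ (Finset.range K).powerset, s ^ T.card := by
        refine Finset.sum_le_sum_of_subset_of_nonneg ?_ fun _ _ _ => by positivity
        intro T hT
        obtain ⟨B, -, rfl⟩ := Finset.mem_image.1 hT
        exact Finset.mem_powerset.2 (Finset.filter_subset _ _)
    _ = (1 + s) ^ K := by
        have := Finset.sum_pow_mul_eq_add_pow s 1 (Finset.range K)
        simp only [one_pow, mul_one, Finset.card_range] at this
        rw [this, add_comm]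

open Classical in
theorem card_filter_range_mul (a b : ℕ) (P : ℕ → Prop) :
    ((Finset.range (a * b)).filter P).card =
      ∑ I ∈ Finset.range a, ((Finset.range b).filter fun x => P (I * b + x)).card := by
  simp only [Finset.card_filter]
  induction a with
  | zero => simp
  | succ a ih => rw [Nat.succ_mul, Finset.sum_range_add, ih, Finset.sum_range_succ]

open Classical in
theorem card_filter_range_add (a b : ℕ) (P : ℕ → Prop) :
    ((Finset.range (a + b)).filter P).card = ((Finset.range a).filter P).card +
      ((Finset.range b).filter fun x => P (a + x)).card := by
  simp only [Finset.card_filter, Finset.sum_range_add]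

open Classical in
theorem card_filter_range_two_pow {K i : ℕ} (hi : i < K) (P : ℕ → Prop) :
    ((Finset.range (2 ^ K)).filter P).card = ∑ I ∈ Finset.range (2 ^ (K - 1 - i)),
      (((Finset.range (2 ^ i)).filter fun x => P (I * 2 ^ (i + 1) + x)).card +
        ((Finset.range (2 ^ i)).filter fun x => P (I * 2 ^ (i + 1) + (2 ^ i + x))).card) := by
  have h1 : 2 ^ K = 2 ^ (K - 1 - i) * 2 ^ (i + 1) := by rw [← pow_add]; congr 1; omega
  rw [h1, card_filter_range_mul]
  refine Finset.sum_congr rfl fun I _ => ?_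
  have h2 : 2 ^ (i + 1) = 2 ^ i + 2 ^ i := by ring
  conv_lhs => rw [show Finset.range (2 ^ (i + 1)) = Finset.range (2 ^ i + 2 ^ i) by rw [h2]]
  rw [card_filter_range_add]

theorem misplaced_left {t : ℕ → ℕ → ℕ} {l i I x : ℕ} (hx : x < 2 ^ i) :
    Misplaced t l i (I * 2 ^ (i + 1) + x) ↔ t i I ≤ l := by
  have h0 : 0 < 2 ^ i := by positivity
  have h1 : (I * 2 ^ (i + 1) + x) / 2 ^ i = 2 * I := by
    rw [pow_succ, show I * (2 ^ i * 2) + x = x + 2 ^ i * (2 * I) by ring,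
      Nat.add_mul_div_left _ _ h0, Nat.div_eq_of_lt hx, zero_add]
  have h2 : (I * 2 ^ (i + 1) + x) / 2 ^ (i + 1) = I := by
    rw [pow_succ, ← Nat.div_div_eq_div_mul, ← pow_succ, h1]; omega
  unfold Misplaced
  rw [h1, h2, if_neg (by omega)]

theorem misplaced_right {t : ℕ → ℕ → ℕ} {l i I x : ℕ} (hx : x < 2 ^ i) :
    Misplaced t l i (I * 2 ^ (i + 1) + (2 ^ i + x)) ↔ l < t i I := by
  have h0 : 0 < 2 ^ i := by positivity
  have h1 : (I * 2 ^ (i + 1) + (2 ^ i + x)) / 2 ^ i = 2 * I + 1 := by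
    rw [pow_succ, show I * (2 ^ i * 2) + (2 ^ i + x) = x + 2 ^ i * (2 * I + 1) by ring,
      Nat.add_mul_div_left _ _ h0, Nat.div_eq_of_lt hx, zero_add]
  have h2 : (I * 2 ^ (i + 1) + (2 ^ i + x)) / 2 ^ (i + 1) = I := by
    rw [pow_succ, ← Nat.div_div_eq_div_mul, ← pow_succ, h1]; omega
  unfold Misplaced
  rw [h1, h2, if_pos (by omega)]

open Classical in
/-- A labelling with few misplaced leaves has many labels. -/
theorem two_pow_le_of_misplaced_le {K d : ℕ} (hK : 0 < K) (t : ℕ → ℕ → ℕ) (L : ℕ → ℕ)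
    (hL : ∀ B < 2 ^ K, L B < d)
    (hmis : (∑ B ∈ Finset.range (2 ^ K),
      (((Finset.range K).filter fun i => Misplaced t (L B) i B).card : ℝ)) ≤ 2 ^ K * K / 200) :
    (2 : ℝ) ^ K * (97 / 100) ^ K ≤ 2 * d * (17 / 16) ^ K := by
  have hK' : (0 : ℝ) < K := by exact_mod_cast hK
  set cost : ℕ → ℕ → ℕ := fun l B => ((Finset.range K).filter fun i => Misplaced t l i B).card
    with hcost
  -- By Markov's inequality, at least half of the leaves are misplaced at no more than $K/100$
  -- levels.
  set G := (Finset.range (2 ^ K)).filter fun B => 100 * cost (L B) B ≤ K with hG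
  set G' := (Finset.range (2 ^ K)).filter fun B => ¬ 100 * cost (L B) B ≤ K with hG'
  have hsum : (G.card : ℝ) + G'.card = 2 ^ K := by
    have := Finset.card_filter_add_card_filter_not (s := Finset.range (2 ^ K))
      fun B => 100 * cost (L B) B ≤ K
    rw [Finset.card_range] at this
    exact_mod_cast this
  have h1 : (G'.card : ℝ) * (K / 100) ≤ 2 ^ K * K / 200 := by
    refine le_trans ?_ hmis
    calc (G'.card : ℝ) * (K / 100) = ∑ _B ∈ G', (K / 100 : ℝ) := by simp
      _ ≤ ∑ B ∈ G', (cost (L B) B : ℝ) := by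
          refine Finset.sum_le_sum fun B hB => ?_
          have := (Finset.mem_filter.1 hB).2
          have h2 : (K : ℝ) ≤ 100 * cost (L B) B := by exact_mod_cast (not_le.1 this).le
          linarith
      _ ≤ _ := Finset.sum_le_sum_of_subset_of_nonneg (Finset.filter_subset _ _)
          fun _ _ _ => by positivity
  have h2 : (2 : ℝ) ^ K / 2 ≤ G.card := by
    have : (G'.card : ℝ) ≤ 2 ^ K / 2 := by
      have : (G'.card : ℝ) * (K / 100) ≤ 2 ^ K / 2 * (K / 100) := by linarith
      exact le_of_mul_le_mul_right this (by positivity)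
    linarith
  -- Each such leaf weighs at least $(97/100)^K$, since $(97/100)^{100} \le 1/16$.
  have h3 : (G.card : ℝ) * (97 / 100) ^ K ≤
      ∑ B ∈ Finset.range (2 ^ K), (1 / 16 : ℝ) ^ cost (L B) B := by
    calc (G.card : ℝ) * (97 / 100) ^ K = ∑ _B ∈ G, (97 / 100 : ℝ) ^ K := by simp
      _ ≤ ∑ B ∈ G, (1 / 16 : ℝ) ^ cost (L B) B := by
          refine Finset.sum_le_sum fun B hB => ?_
          have hB := (Finset.mem_filter.1 hB).2
          calc (97 / 100 : ℝ) ^ K ≤ (97 / 100) ^ (100 * cost (L B) B) :=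
                pow_le_pow_of_le_one (by norm_num) (by norm_num) hB
            _ = ((97 / 100) ^ 100) ^ cost (L B) B := pow_mul _ _ _
            _ ≤ _ := pow_le_pow_left₀ (by positivity) (by norm_num) _
      _ ≤ _ := Finset.sum_le_sum_of_subset_of_nonneg (Finset.filter_subset _ _)
          fun _ _ _ => by positivity
  -- Summing over all `d` labels removes the dependence of the label on the leaf.
  have h4 : ∑ B ∈ Finset.range (2 ^ K), (1 / 16 : ℝ) ^ cost (L B) B ≤ d * (17 / 16) ^ K := by
    calc ∑ B ∈ Finset.range (2 ^ K), (1 / 16 : ℝ) ^ cost (L B) B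
        ≤ ∑ B ∈ Finset.range (2 ^ K), ∑ l ∈ Finset.range d, (1 / 16 : ℝ) ^ cost l B := by
          refine Finset.sum_le_sum fun B hB => ?_
          exact Finset.single_le_sum (f := fun l => (1 / 16 : ℝ) ^ cost l B)
            (fun _ _ => by positivity) (Finset.mem_range.2 (hL B (Finset.mem_range.1 hB)))
      _ = ∑ l ∈ Finset.range d, ∑ B ∈ Finset.range (2 ^ K), (1 / 16 : ℝ) ^ cost l B :=
          Finset.sum_comm
      _ ≤ ∑ _l ∈ Finset.range d, (17 / 16 : ℝ) ^ K := by
          refine Finset.sum_le_sum fun l _ => ?_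
          have := sum_pow_card_misplaced_le t l K (s := 1 / 16) (by norm_num)
          rw [show (1 + 1 / 16 : ℝ) = 17 / 16 by norm_num] at this
          exact this
      _ = _ := by simp
  have h5 : (2 : ℝ) ^ K / 2 * (97 / 100) ^ K ≤ G.card * (97 / 100) ^ K :=
    mul_le_mul_of_nonneg_right h2 (by positivity)
  linarith

-- Here `p` and `f` are the deletions and labels of the incoming ports, `q` and `g` those of the
-- outgoing ones. The misplaced pairs (leaf, level) have density at most $7\varepsilon \le 1/200$:
-- $\varepsilon$ from the thresholds and $3\varepsilon$ from the unusable ports of each kind.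
open Classical in
theorem two_pow_le_of_labelling {K d : ℕ} (hK : 0 < K) (hd0 : 0 < d) {ε : ℝ} (hε : 0 < ε)
    (hε' : 1400 * ε ≤ 1) {E : ℕ → ℕ → Finset ℕ}
    (hE : ∀ N, 0 < N → ∀ X Y : Finset ℕ, X ⊆ Finset.range N → Y ⊆ Finset.range N →
        ε * N ≤ X.card → ε * N ≤ Y.card → ∃ y ∈ Y, ∃ x ∈ X, x ∈ E N y)
    (p q : ℕ → ℕ → Prop) (f g : ℕ → ℕ → ℕ)
    (hfg : ∀ B < 2 ^ K, ∀ j < K, ∀ i < K, j ∈ E K i → ¬ p B j → ¬ q B i → f B j < g B i)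
    (hgf : ∀ i < K, ∀ I < 2 ^ (K - 1 - i), ∀ x < 2 ^ i, ∀ y < 2 ^ i, x ∈ E (2 ^ i) y →
      ¬ q (I * 2 ^ (i + 1) + x) i → ¬ p (I * 2 ^ (i + 1) + (2 ^ i + y)) i →
      g (I * 2 ^ (i + 1) + x) i < f (I * 2 ^ (i + 1) + (2 ^ i + y)) i)
    (hd : ∀ B < 2 ^ K, ∀ i < K, ¬ q B i → g B i < d)
    (hcount : ∑ B ∈ Finset.range (2 ^ K), ((((Finset.range K).filter (p B)).card : ℝ) +
      ((Finset.range K).filter (q B)).card) ≤ ε ^ 2 * (2 ^ K * K)) :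
    (2 : ℝ) ^ K * (97 / 100) ^ K ≤ 2 * d * (17 / 16) ^ K := by
  have hK' : (0 : ℝ) < K := by exact_mod_cast hK
  set a : ℕ → ℝ := fun B => (((Finset.range K).filter (p B)).card : ℝ) +
      ((Finset.range K).filter (q B)).card with ha
  have hlev : ∀ B, ∃ L, B < 2 ^ K → L < d ∧ (a B ≤ ε * K →
      (((Finset.range K).filter fun i => p B i ∨ L ≤ f B i).card : ℝ) ≤ 2 * ε * K ∧
      (((Finset.range K).filter fun i => q B i ∨ g B i < L).card : ℝ) ≤ 2 * ε * K) := by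
    intro B
    by_cases hB : B < 2 ^ K
    · by_cases haB : a B ≤ ε * K
      · have h1 : (0 : ℝ) ≤ ((Finset.range K).filter (p B)).card := by positivity
        have h2 : (0 : ℝ) ≤ ((Finset.range K).filter (q B)).card := by positivity
        simp only [ha] at haB
        obtain ⟨L, hL, hL'⟩ := exists_block_level hK hε (by linarith) (hE K hK) (p B) (q B) (f B)
          (g B) (by linarith) (by linarith) (hfg B hB) (hd B hB)
        exact ⟨L, fun _ => ⟨hL, fun _ => hL'⟩⟩
      · exact ⟨0, fun _ => ⟨hd0, fun h => absurd h haB⟩⟩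
    · exact ⟨0, fun h => absurd h hB⟩
  choose L hL using hlev
  -- `P` and `Q` mark unusable ports: those deleted, on the wrong side of the level of their block,
  -- or in a block with too many deletions.
  obtain ⟨P, hP⟩ : ∃ P : ℕ → ℕ → Prop, ∀ B i, P B i ↔ (¬ a B ≤ ε * K ∨ p B i ∨ L B ≤ f B i) :=
    ⟨_, fun _ _ => Iff.rfl⟩
  obtain ⟨Q, hQ⟩ : ∃ Q : ℕ → ℕ → Prop, ∀ B i, Q B i ↔ (¬ a B ≤ ε * K ∨ q B i ∨ g B i < L B) :=
    ⟨_, fun _ _ => Iff.rfl⟩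
  -- In a block with more than $\varepsilon K$ deletions all ports are unusable, but then
  -- $a_B/\varepsilon$ already exceeds $K$.
  have hbad : ∀ B < 2 ^ K, ∀ S R : ℕ → Prop, (∀ i, S i ↔ (¬ a B ≤ ε * K ∨ R i)) →
      (a B ≤ ε * K → (((Finset.range K).filter R).card : ℝ) ≤ 2 * ε * K) →
      (((Finset.range K).filter S).card : ℝ) ≤ 2 * ε * K + a B / ε := by
    intro B hB S R hS hR
    have ha0 : 0 ≤ a B / ε := div_nonneg (by simp only [ha]; positivity) hε.le
    by_cases haB : a B ≤ ε * K
    · have : (Finset.range K).filter S = (Finset.range K).filter R :=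
        Finset.filter_congr fun i _ => by simp [hS, haB]
      rw [this]
      linarith [hR haB]
    · have h1 : (((Finset.range K).filter S).card : ℝ) ≤ K := by
        have := Finset.card_filter_le (Finset.range K) S
        rw [Finset.card_range] at this
        exact_mod_cast this
      have h2 : (K : ℝ) ≤ a B / ε := by
        rw [le_div_iff₀ hε]; linarith
      have : 0 < ε * K := by positivity
      linarith
  have hsumbad : ∀ S : ℕ → ℕ → Prop, (∀ B < 2 ^ K,
      (((Finset.range K).filter (S B)).card : ℝ) ≤ 2 * ε * K + a B / ε) →
      ∑ B ∈ Finset.range (2 ^ K), (((Finset.range K).filter (S B)).card : ℝ) ≤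
        3 * ε * (2 ^ K * K) := by
    intro S hS
    calc _ ≤ ∑ B ∈ Finset.range (2 ^ K), (2 * ε * K + a B / ε) :=
          Finset.sum_le_sum fun B hB => hS B (Finset.mem_range.1 hB)
      _ = 2 ^ K * (2 * ε * K) + (∑ B ∈ Finset.range (2 ^ K), a B) / ε := by
          rw [Finset.sum_add_distrib, Finset.sum_div]; simp
      _ ≤ 2 ^ K * (2 * ε * K) + (ε ^ 2 * (2 ^ K * K)) / ε := by gcongr
      _ = _ := by field_simp; ring
  have hPs := hsumbad P fun B hB => hbad B hB _ (fun i => p B i ∨ L B ≤ f B i) (hP B)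
    fun h => by convert ((hL B hB).2 h).1
  have hQs := hsumbad Q fun B hB => hbad B hB _ (fun i => q B i ∨ g B i < L B) (hQ B)
    fun h => by convert ((hL B hB).2 h).2
  have hthr : ∀ i I, ∃ t, i < K → I < 2 ^ (K - 1 - i) →
      (((Finset.range (2 ^ i)).filter fun x => t ≤ L (I * 2 ^ (i + 1) + x)).card : ℝ) ≤
        ε * (2 ^ i : ℕ) +
          ((Finset.range (2 ^ i)).filter fun x => Q (I * 2 ^ (i + 1) + x) i).card ∧
      (((Finset.range (2 ^ i)).filter fun x => L (I * 2 ^ (i + 1) + (2 ^ i + x)) < t).card : ℝ) ≤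
        ε * (2 ^ i : ℕ) +
          ((Finset.range (2 ^ i)).filter fun x => P (I * 2 ^ (i + 1) + (2 ^ i + x)) i).card := by
    intro i I
    by_cases hi : i < K
    · by_cases hI : I < 2 ^ (K - 1 - i)
      · obtain ⟨t, ht⟩ := exists_separating_threshold (N := 2 ^ i) (by positivity) hε
          (hE (2 ^ i) (by positivity)) (fun x => Q (I * 2 ^ (i + 1) + x) i)
          (fun x => P (I * 2 ^ (i + 1) + (2 ^ i + x)) i) (fun x => L (I * 2 ^ (i + 1) + x))
          (fun x => L (I * 2 ^ (i + 1) + (2 ^ i + x))) (by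
            intro x hx y hy hxy hQx hPy
            simp only [hQ, hP, not_or, not_lt, not_le] at hQx hPy
            -- The level of the left block is at most the label of its outgoing port, which is less
            -- than that of the incoming port, which is less than the level of the right block.
            have := hgf i hi I hI x hx y hy hxy hQx.2.1 hPy.2.1
            omega)
        exact ⟨t, fun _ _ => ht⟩
      · exact ⟨0, fun _ h => absurd h hI⟩
    · exact ⟨0, fun h => absurd h hi⟩
  choose t ht using hthr
  refine two_pow_le_of_misplaced_le hK t L (fun B hB => (hL B hB).1) ?_
  have hswap : ∀ S : ℕ → ℕ → Prop,
      ∑ B ∈ Finset.range (2 ^ K), (((Finset.range K).filter (S B)).card : ℝ) =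
        ∑ i ∈ Finset.range K, (((Finset.range (2 ^ K)).filter fun B => S B i).card : ℝ) := by
    intro S
    simp only [Finset.card_filter, Nat.cast_sum]
    exact Finset.sum_comm
  rw [hswap fun B i => Misplaced t (L B) i B]
  rw [hswap] at hPs hQs
  have hlevel : ∀ i ∈ Finset.range K,
      (((Finset.range (2 ^ K)).filter fun B => Misplaced t (L B) i B).card : ℝ) ≤
        ε * 2 ^ K + ((Finset.range (2 ^ K)).filter fun B => Q B i).card +
          ((Finset.range (2 ^ K)).filter fun B => P B i).card := by
    intro i hi
    have hi := Finset.mem_range.1 hi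
    rw [card_filter_range_two_pow hi fun B => Misplaced t (L B) i B,
      card_filter_range_two_pow hi fun B => Q B i, card_filter_range_two_pow hi fun B => P B i]
    simp only [Nat.cast_sum, Nat.cast_add]
    have h2K : ε * (2 : ℝ) ^ K = ∑ _I ∈ Finset.range (2 ^ (K - 1 - i)), 2 * (ε * (2 ^ i : ℕ)) := by
      rw [Finset.sum_const, Finset.card_range, nsmul_eq_mul]
      have : (2 : ℝ) ^ K = 2 ^ (K - 1 - i) * (2 ^ i * 2) := by
        rw [← pow_succ, ← pow_add]; congr 1; omega
      rw [this]; push_cast; ring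
    rw [h2K, ← Finset.sum_add_distrib, ← Finset.sum_add_distrib]
    refine Finset.sum_le_sum fun I hI => ?_
    obtain ⟨h1, h2⟩ := ht i I hi (Finset.mem_range.1 hI)
    have e1 : ((Finset.range (2 ^ i)).filter fun x =>
        Misplaced t (L (I * 2 ^ (i + 1) + x)) i (I * 2 ^ (i + 1) + x)) =
        (Finset.range (2 ^ i)).filter fun x => t i I ≤ L (I * 2 ^ (i + 1) + x) :=
      Finset.filter_congr fun x hx => misplaced_left (Finset.mem_range.1 hx)
    have e2 : ((Finset.range (2 ^ i)).filter fun x =>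
        Misplaced t (L (I * 2 ^ (i + 1) + (2 ^ i + x))) i (I * 2 ^ (i + 1) + (2 ^ i + x))) =
        (Finset.range (2 ^ i)).filter fun x => L (I * 2 ^ (i + 1) + (2 ^ i + x)) < t i I :=
      Finset.filter_congr fun x hx => misplaced_right (Finset.mem_range.1 hx)
    rw [e1, e2]
    have n1 : (0 : ℝ) ≤ ((Finset.range (2 ^ i)).filter fun x =>
      Q (I * 2 ^ (i + 1) + (2 ^ i + x)) i).card := by positivity
    have n2 : (0 : ℝ) ≤ ((Finset.range (2 ^ i)).filter fun x =>
      P (I * 2 ^ (i + 1) + x) i).card := by positivity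
    linarith
  refine (Finset.sum_le_sum hlevel).trans ?_
  rw [Finset.sum_add_distrib, Finset.sum_add_distrib]
  simp only [Finset.sum_const, Finset.card_range, nsmul_eq_mul]
  have hpos : 0 < (2 : ℝ) ^ K * K := by positivity
  have h1 : 1400 * ε * (2 ^ K * K) ≤ 1 * (2 ^ K * K) := mul_le_mul_of_nonneg_right hε' hpos.le
  linarith


/-! ### The depth-robust graphs -/

/-- Vertices `B * (2 * K) + i` and `B * (2 * K) + (K + i)` for `i < K` are the incoming and the
outgoing ports of the block `B`. The edges are those of a line, those of the graph `E K` in each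
block, and those of the graph `E (2 ^ i)` from the `i`-th outgoing ports of the blocks in the left
half to the `i`-th incoming ports of those in the right half of each dyadic interval of blocks of
length `2 ^ (i + 1)`. -/
def robustAdj (E : ℕ → ℕ → Finset ℕ) (K u v : ℕ) : Prop :=
  v = u + 1 ∨
  (∃ j ∈ E K (v % (2 * K) - K), u < v ∧ u = v / (2 * K) * (2 * K) + j) ∨
  ∃ x ∈ E (2 ^ (v % (2 * K))) (v / (2 * K) % 2 ^ (v % (2 * K))), u < v ∧
    u = (v / (2 * K) / 2 ^ (v % (2 * K) + 1) * 2 ^ (v % (2 * K) + 1) + x) * (2 * K) +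
      (K + v % (2 * K))

/-- The formulas for `u` also apply to vertices `v` that are not the intended kind of port, partly
through truncated subtraction. The explicit conditions $u < v$ make these extra edges harmless. -/
theorem robustAdj.lt {E : ℕ → ℕ → Finset ℕ} {K u v : ℕ} (h : robustAdj E K u v) : u < v := by
  rcases h with h | ⟨j, -, h, -⟩ | ⟨x, -, h, -⟩ <;> omega

theorem robustAdj_block {E : ℕ → ℕ → Finset ℕ} {K B i j : ℕ} (hi : i < K) (hj : j < K)
    (h : j ∈ E K i) : robustAdj E K (B * (2 * K) + j) (B * (2 * K) + (K + i)) := by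
  have h1 : (B * (2 * K) + (K + i)) / (2 * K) = B := by
    rw [mul_comm, Nat.mul_add_div (by omega), Nat.div_eq_of_lt (by omega), add_zero]
  have h2 : (B * (2 * K) + (K + i)) % (2 * K) = K + i := by
    rw [mul_comm, Nat.mul_add_mod, Nat.mod_eq_of_lt (by omega)]
  refine Or.inr (Or.inl ⟨j, ?_, by omega, by rw [h1]⟩)
  rw [h2, Nat.add_sub_cancel_left]
  exact h

theorem robustAdj_tree {E : ℕ → ℕ → Finset ℕ} {K i I x y : ℕ} (hi : i < K) (hx : x < 2 ^ i)
    (hy : y < 2 ^ i) (h : x ∈ E (2 ^ i) y) :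
    robustAdj E K ((I * 2 ^ (i + 1) + x) * (2 * K) + (K + i))
      ((I * 2 ^ (i + 1) + (2 ^ i + y)) * (2 * K) + i) := by
  set B := I * 2 ^ (i + 1) + (2 ^ i + y) with hB
  have h1 : (B * (2 * K) + i) / (2 * K) = B := by
    rw [mul_comm, Nat.mul_add_div (by omega), Nat.div_eq_of_lt (by omega), add_zero]
  have h2 : (B * (2 * K) + i) % (2 * K) = i := by
    rw [mul_comm, Nat.mul_add_mod, Nat.mod_eq_of_lt (by omega)]
  have h3 : B % 2 ^ i = y := by
    rw [hB, show I * 2 ^ (i + 1) + (2 ^ i + y) = 2 ^ i * (2 * I + 1) + y by ring,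
      Nat.mul_add_mod, Nat.mod_eq_of_lt hy]
  have h4 : B / 2 ^ (i + 1) = I := by
    rw [hB, mul_comm, Nat.mul_add_div (by positivity), Nat.div_eq_of_lt, add_zero]
    rw [pow_succ]; omega
  refine Or.inr (Or.inr ⟨x, ?_, ?_, ?_⟩)
  · rw [h1, h2, h3]; exact h
  · have h5 : I * 2 ^ (i + 1) + x + 1 ≤ B := by omega
    have h6 := Nat.mul_le_mul_right (2 * K) h5
    rw [Nat.add_mul _ 1] at h6
    omega
  · rw [h1, h2, h4]

/-- The graph on `n` vertices with the edges `robustAdj E K`. -/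
def robustGraph (E : ℕ → ℕ → Finset ℕ) (K n : ℕ) : Digraph (Fin n) :=
  ⟨fun u v => robustAdj E K u v⟩

theorem isDAG_robustGraph (E : ℕ → ℕ → Finset ℕ) (K n : ℕ) : IsDAG (robustGraph E K n) := by
  intro v hv
  have : ∀ u w : Fin n, Relation.TransGen (robustGraph E K n).Adj u w → u < w := by
    intro u w h
    induction h with
    | single h => exact robustAdj.lt h
    | tail _ h ih => exact ih.trans (robustAdj.lt h)
  exact lt_irrefl _ (this v v hv)

theorem indegreeLE_robustGraph {E : ℕ → ℕ → Finset ℕ} {τ : ℕ} (hE : ∀ N y, (E N y).card ≤ τ)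
    (K n : ℕ) : IndegreeLE (robustGraph E K n) (1 + τ + τ) := by
  intro v
  set S : Finset ℕ := ({(v : ℕ) - 1} ∪ (E K (v % (2 * K) - K)).image fun j =>
    (v : ℕ) / (2 * K) * (2 * K) + j) ∪
    (E (2 ^ (v % (2 * K))) (v / (2 * K) % 2 ^ (v % (2 * K)))).image fun x =>
      ((v : ℕ) / (2 * K) / 2 ^ (v % (2 * K) + 1) * 2 ^ (v % (2 * K) + 1) + x) * (2 * K) +
        (K + v % (2 * K)) with hS
  have hSc : S.card ≤ 1 + τ + τ :=
    (Finset.card_union_le _ _).trans (Nat.add_le_add ((Finset.card_union_le _ _).trans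
      (Nat.add_le_add (by simp) (Finset.card_image_le.trans (hE _ _))))
      (Finset.card_image_le.trans (hE _ _)))
  refine le_trans ?_ hSc
  rw [← Set.ncard_coe_finset]
  refine Set.ncard_le_ncard_of_injOn (fun u : Fin n => (u : ℕ)) ?_ Fin.val_injective.injOn
  intro u hu
  rw [Finset.mem_coe, hS, Finset.mem_union, Finset.mem_union, Finset.mem_singleton,
    Finset.mem_image, Finset.mem_image]
  rcases hu with h | ⟨j, hj, -, h⟩ | ⟨x, hx, -, h⟩
  · exact Or.inl (Or.inl (by omega))
  · exact Or.inl (Or.inr ⟨j, hj, h.symm⟩)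
  · exact Or.inr ⟨x, hx, h.symm⟩

/-- The vertices of `G - S` can be labelled by the lengths of the longest paths which end there. -/
theorem exists_path_labelling {n : ℕ} {G : Digraph (Fin n)} (hG : ∀ u v, G.Adj u v → u < v)
    (S : Finset (Fin n)) : ∃ lam : Fin n → ℕ, (∀ u v, DelAdj G S u v → lam u < lam v) ∧
      ∀ v ∉ S, ∃ p, IsPath G p ∧ (∀ w ∈ p, w ∉ S) ∧ p.length = lam v + 1 := by
  set T : Fin n → Set ℕ := fun v => {k | ∃ p, IsPath G p ∧ (∀ w ∈ p, w ∉ S) ∧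
    p.getLast? = some v ∧ p.length = k + 1} with hT
  have hbdd : ∀ v, BddAbove (T v) := by
    intro v
    refine ⟨n, fun k hk => ?_⟩
    obtain ⟨p, hp, -, -, hk⟩ := hk
    have := hp.2.2.length_le_card
    rw [Fintype.card_fin] at this
    omega
  have hne : ∀ v ∉ S, (T v).Nonempty := fun v hv =>
    ⟨0, [v], ⟨by simp, by simp, by simp⟩, by simpa using hv, by simp, by simp⟩
  refine ⟨fun v => sSup (T v), fun u v huv => ?_, fun v hv => ?_⟩
  · obtain ⟨p, hp, hpS, hpu, hk⟩ := Nat.sSup_mem (hne u huv.2.1) (hbdd u)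
    refine Nat.lt_of_succ_le (le_csSup (hbdd v) ⟨p ++ [v], ?_, ?_, by simp, by simp [hk]⟩)
    · have hchain : (p ++ [v]).IsChain G.Adj := by
        rw [List.isChain_append]
        refine ⟨hp.2.1, by simp, ?_⟩
        intro x hx y hy
        rw [hpu] at hx
        simp only [Option.mem_def, Option.some.injEq, List.head?_cons] at hx hy
        rw [← hx, ← hy]
        exact huv.1
      refine ⟨by simp, hchain, ?_⟩
      -- Edges increase the index, so the extended list has no repetition.
      have := List.isChain_iff_pairwise.1 (hchain.imp hG)
      exact this.imp fun h => h.ne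
    · intro w hw
      rw [List.mem_append, List.mem_singleton] at hw
      rcases hw with hw | rfl
      · exact hpS w hw
      · exact huv.2.2
  · obtain ⟨p, hp, hpS, -, hk⟩ := Nat.sSup_mem (hne v hv) (hbdd v)
    exact ⟨p, hp, hpS, hk⟩

/-- The labels are those of longest paths. A path ending at a vertex with label $\lambda$ has
$\lambda + 1$ vertices, so paths of at most `d` vertices mean labels below `d`. -/
theorem two_pow_le_of_forall_path_length_lt {E : ℕ → ℕ → Finset ℕ} {ε : ℝ} (hε : 0 < ε)
    (hε' : 1400 * ε ≤ 1)
    (hE : ∀ N, 0 < N → ∀ X Y : Finset ℕ, X ⊆ Finset.range N → Y ⊆ Finset.range N →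
        ε * N ≤ X.card → ε * N ≤ Y.card → ∃ y ∈ Y, ∃ x ∈ X, x ∈ E N y)
    {K n d : ℕ} (hK : 0 < K) (hd : 0 < d) (hKn : 2 ^ K * (2 * K) ≤ n) (S : Finset (Fin n))
    (hS : (S.card : ℝ) ≤ ε ^ 2 * (2 ^ K * K))
    (hpath : ∀ p, IsPath (robustGraph E K n) p → (∀ w ∈ p, w ∉ S) → p.length ≤ d) :
    (2 : ℝ) ^ K * (97 / 100) ^ K ≤ 2 * d * (17 / 16) ^ K := by
  classical
  obtain ⟨lam₀, hlam₀, hlen⟩ := exists_path_labelling (G := robustGraph E K n)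
    (fun u v h => robustAdj.lt h) S
  set SN : Finset ℕ := S.map Fin.valEmbedding with hSN
  set lam : ℕ → ℕ := fun a => if h : a < n then lam₀ ⟨a, h⟩ else 0 with hlam
  have hnot : ∀ a (h : a < n), a ∉ SN → (⟨a, h⟩ : Fin n) ∉ S := fun a h ha hS =>
    ha (Finset.mem_map.2 ⟨⟨a, h⟩, hS, rfl⟩)
  have hlt : ∀ a b, a < n → b < n → robustAdj E K a b → a ∉ SN → b ∉ SN → lam a < lam b := by
    intro a b ha hb hab haS hbS
    simp only [hlam, ha, hb, dif_pos]
    exact hlam₀ ⟨a, ha⟩ ⟨b, hb⟩ ⟨hab, hnot a ha haS, hnot b hb hbS⟩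
  have hrange : ∀ B < 2 ^ K, ∀ r < 2 * K, B * (2 * K) + r < n := by
    intro B hB r hr
    have := Nat.mul_le_mul_right (2 * K) (Nat.succ_le_of_lt hB)
    rw [Nat.succ_mul] at this
    omega
  refine two_pow_le_of_labelling hK hd hε hε' hE (fun B i => B * (2 * K) + i ∈ SN)
    (fun B i => B * (2 * K) + (K + i) ∈ SN) (fun B i => lam (B * (2 * K) + i))
    (fun B i => lam (B * (2 * K) + (K + i))) ?_ ?_ ?_ ?_
  · intro B hB j hj i hi hji hp hq
    exact hlt _ _ (hrange B hB j (by omega)) (hrange B hB (K + i) (by omega))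
      (robustAdj_block hi hj hji) hp hq
  · intro i hi I hI x hx y hy hxy hq hp
    have hB : I * 2 ^ (i + 1) + (2 ^ i + 2 ^ i) ≤ 2 ^ K := by
      have h1 : 2 ^ K = 2 ^ (K - 1 - i) * 2 ^ (i + 1) := by rw [← pow_add]; congr 1; omega
      have h2 := Nat.mul_le_mul_right (2 ^ (i + 1)) (Nat.succ_le_of_lt hI)
      have h3 : 2 ^ (i + 1) = 2 ^ i + 2 ^ i := by ring
      rw [Nat.succ_mul] at h2
      omega
    exact hlt _ _ (hrange _ (by omega) (K + i) (by omega)) (hrange _ (by omega) i (by omega))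
      (robustAdj_tree hi hx hy hxy) hq hp
  · intro B hB i hi hq
    have h1 := hrange B hB (K + i) (by omega)
    obtain ⟨p, hp, hpS, hpl⟩ := hlen ⟨_, h1⟩ (hnot _ h1 hq)
    have := hpath p hp hpS
    simp only [hlam, h1, dif_pos]
    omega
  · refine le_trans ?_ hS
    have h1 : ∑ B ∈ Finset.range (2 ^ K),
        (((Finset.range K).filter fun i => B * (2 * K) + i ∈ SN).card +
          ((Finset.range K).filter fun i => B * (2 * K) + (K + i) ∈ SN).card) ≤ S.card := by
      have h2 := card_filter_range_mul (2 ^ K) (2 * K) (· ∈ SN)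
      have h3 : ((Finset.range (2 ^ K * (2 * K))).filter (· ∈ SN)).card ≤ S.card := by
        rw [← Finset.card_map Fin.valEmbedding (s := S)]
        refine Finset.card_le_card fun a ha => ?_
        exact (Finset.mem_filter.1 ha).2
      calc _ = ∑ B ∈ Finset.range (2 ^ K),
            ((Finset.range (2 * K)).filter fun i => B * (2 * K) + i ∈ SN).card := by
            refine Finset.sum_congr rfl fun B _ => ?_
            have := card_filter_range_add K K fun i => B * (2 * K) + i ∈ SN
            rw [← two_mul] at this
            convert this.symm
        _ ≤ _ := by
            refine le_trans (le_of_eq ?_) h3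
            convert h2.symm
    have h4 : ((∑ B ∈ Finset.range (2 ^ K),
        (((Finset.range K).filter fun i => B * (2 * K) + i ∈ SN).card +
          ((Finset.range K).filter fun i => B * (2 * K) + (K + i) ∈ SN).card) : ℕ) : ℝ) ≤
        S.card := by exact_mod_cast h1
    push_cast at h4
    refine (Finset.sum_congr rfl fun B _ => ?_).trans_le h4
    congr!

theorem exists_bound_pow_growth : ∃ K₀ : ℕ, 0 < K₀ ∧ ∀ K : ℕ, K₀ ≤ K →
    (4096 : ℝ) * K ^ 2 < (3 / 2) ^ K := by
  have h := tendsto_pow_const_div_const_pow_of_one_lt 2 (show (1 : ℝ) < 3 / 2 by norm_num)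
  have h1 := h.eventually (gt_mem_nhds (show (0 : ℝ) < 1 / 4096 by norm_num))
  obtain ⟨K₀, hK₀⟩ := Filter.eventually_atTop.1 h1
  refine ⟨K₀ + 1, by omega, fun K hK => ?_⟩
  have := hK₀ K (by omega)
  rw [div_lt_iff₀ (by positivity)] at this
  linarith

/-- After cubing, $n^{2/3}$ becomes $n^2 \le 64 K^2 4^K$, and $(2 \cdot 97/100)^3 > \frac32 \cdot 4
\cdot (17/16)^3$ leaves a factor $(3/2)^K$ to beat $4096 K^2$. -/
theorem not_two_pow_le {K n d : ℕ} (hn : 1 ≤ n) (hK : (4096 : ℝ) * K ^ 2 < (3 / 2) ^ K)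
    (hnK : n ≤ 8 * K * 2 ^ K) (hd : (d : ℝ) ≤ 2 * (n : ℝ) ^ (2 / 3 : ℝ)) :
    ¬ (2 : ℝ) ^ K * (97 / 100) ^ K ≤ 2 * d * (17 / 16) ^ K := by
  intro h
  set z : ℝ := (n : ℝ) ^ (2 / 3 : ℝ) with hz
  have hn0 : (0 : ℝ) ≤ n := by positivity
  have hz3 : z ^ 3 = (n : ℝ) ^ 2 := by
    rw [hz, ← Real.rpow_natCast, ← Real.rpow_mul hn0, ← Real.rpow_natCast]; norm_num
  have h1 : (2 : ℝ) ^ K * (97 / 100) ^ K ≤ 4 * z * (17 / 16) ^ K := by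
    refine h.trans (mul_le_mul_of_nonneg_right ?_ (by positivity))
    linarith
  have h2 := pow_le_pow_left₀ (by positivity) h1 3
  have h3 : (n : ℝ) ≤ 8 * K * 2 ^ K := by exact_mod_cast hnK
  have h4 := pow_le_pow_left₀ hn0 h3 2
  have h5 : ((2 : ℝ) ^ K * (97 / 100) ^ K) ^ 3 ≤
      64 * (8 * K * 2 ^ K) ^ 2 * ((17 / 16) ^ K) ^ 3 := by
    refine h2.trans ?_
    rw [mul_pow, mul_pow, hz3]
    refine mul_le_mul_of_nonneg_right ?_ (by positivity)
    linarith
  have h6 : (3 / 2 : ℝ) ^ K * (4 ^ K * ((17 / 16) ^ 3) ^ K) ≤ ((2 : ℝ) ^ K * (97 / 100) ^ K) ^ 3 := by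
    rw [← mul_pow, ← mul_pow, ← mul_pow, ← pow_mul, mul_comm K 3, pow_mul]
    exact pow_le_pow_left₀ (by positivity) (by norm_num) _
  have h7 : 64 * (8 * K * 2 ^ K) ^ 2 * ((17 / 16) ^ K) ^ 3 =
      (4096 : ℝ) * K ^ 2 * (4 ^ K * ((17 / 16) ^ 3) ^ K) := by
    have : (4 : ℝ) ^ K = (2 ^ K) ^ 2 := by rw [← pow_mul, mul_comm, pow_mul]; norm_num
    rw [this, ← pow_mul (17 / 16 : ℝ) 3 K, mul_comm 3 K, pow_mul (17 / 16 : ℝ) K 3]; ring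
  rw [h7] at h5
  have h8 : (3 / 2 : ℝ) ^ K ≤ 4096 * K ^ 2 :=
    le_of_mul_le_mul_right (h6.trans h5) (by positivity)
  linarith

theorem isPath_finRange {E : ℕ → ℕ → Finset ℕ} {K n : ℕ} (hn : 1 ≤ n) :
    IsPath (robustGraph E K n) (List.finRange n) := by
  refine ⟨?_, ?_, List.nodup_finRange n⟩
  · intro h
    have := congrArg List.length h
    simp at this
    omega
  · rw [List.isChain_iff_getElem]
    intro i hi
    refine Or.inl ?_
    simp

theorem exists_isDepthRobustFamily :
    ∃ (c : ℝ) (δ : ℕ) (H : ∀ n, Digraph (Fin n)), 0 < c ∧ IsDepthRobustFamily c δ H := by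
  obtain ⟨τ, E, hEc, hE⟩ := exists_mixing (η := 1 / 1400) (by norm_num) (by norm_num)
  obtain ⟨K₀, hK₀, hgrowth⟩ := exists_bound_pow_growth
  set n₀ := 2 ^ K₀ * (2 * K₀) with hn₀
  have hn₀pos : (0 : ℝ) < n₀ := by
    have : 0 < n₀ := by positivity
    exact_mod_cast this
  set κ : ℕ → ℕ := fun n => Nat.findGreatest (fun K => 2 ^ K * (2 * K) ≤ n) n with hκ
  -- The first constant gives $|S| \le \varepsilon^2 2^K K$ because $n \le 8K2^K$. The second forces
  -- $S = \emptyset$ for $n < n_0$, where the line through all vertices is the required path.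
  refine ⟨min (((1 / 1400 : ℝ)) ^ 2 / 8) (1 / (2 * n₀)), 1 + τ + τ,
    fun n => robustGraph E (κ n) n, by positivity, fun n hn =>
      ⟨isDAG_robustGraph _ _ _, indegreeLE_robustGraph hEc _ _, fun S hS => ?_⟩⟩
  have hn' : (1 : ℝ) ≤ n := by exact_mod_cast hn
  have hz1 : 1 ≤ (n : ℝ) ^ (2 / 3 : ℝ) := Real.one_le_rpow hn' (by norm_num)
  rcases lt_or_ge n n₀ with hlt | hge
  · have hS0 : S = ∅ := by
      have h1 : (n : ℝ) < n₀ := by exact_mod_cast hlt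
      have h2 : (S.card : ℝ) < 1 := by
        refine hS.trans_lt ?_
        calc _ ≤ 1 / (2 * n₀) * (n : ℝ) :=
              mul_le_mul_of_nonneg_right (min_le_right _ _) (by positivity)
          _ < 1 := by rw [div_mul_eq_mul_div, div_lt_one (by positivity)]; linarith
      have : S.card < 1 := by exact_mod_cast h2
      exact Finset.card_eq_zero.1 (by omega)
    refine ⟨List.finRange n, isPath_finRange hn, by simp [hS0], ?_⟩
    rw [List.length_finRange]
    calc (n : ℝ) ^ (2 / 3 : ℝ) ≤ (n : ℝ) ^ (1 : ℝ) :=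
          Real.rpow_le_rpow_of_exponent_le hn' (by norm_num)
      _ = n := Real.rpow_one _
  · have hK₀n : K₀ ≤ n := by
      have : K₀ * 1 ≤ 2 * K₀ * 2 ^ K₀ := Nat.mul_le_mul (by omega) Nat.one_le_two_pow
      rw [mul_comm (2 * K₀)] at this
      omega
    have hK : K₀ ≤ κ n := Nat.le_findGreatest hK₀n hge
    have hKn : 2 ^ κ n * (2 * κ n) ≤ n :=
      Nat.findGreatest_spec (P := fun K => 2 ^ K * (2 * K) ≤ n) hK₀n hge
    -- By maximality of `κ n`: passing from $K$ to $K+1$ multiplies $2^K \cdot 2K$ by at most $4$.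
    have hnK : n ≤ 8 * κ n * 2 ^ κ n := by
      by_contra! hcon
      have h1 : 2 ^ (κ n + 1) * (2 * (κ n + 1)) ≤ n := by
        refine le_trans ?_ hcon.le
        rw [pow_succ]
        have : 1 ≤ κ n := by omega
        nlinarith [Nat.one_le_two_pow (n := κ n)]
      have h2 : κ n + 1 ≤ n := by
        have : (κ n + 1) * 1 ≤ 2 * (κ n + 1) * 2 ^ (κ n + 1) :=
          Nat.mul_le_mul (by omega) Nat.one_le_two_pow
        rw [mul_comm (2 * (κ n + 1))] at this
        omega
      have := Nat.le_findGreatest (P := fun K => 2 ^ K * (2 * K) ≤ n) h2 h1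
      change κ n + 1 ≤ κ n at this
      omega
    by_contra! hcon
    set d := ⌈(n : ℝ) ^ (2 / 3 : ℝ)⌉₊ with hd
    have hd2 : (d : ℝ) ≤ 2 * (n : ℝ) ^ (2 / 3 : ℝ) := by
      have := Nat.ceil_lt_add_one (show 0 ≤ (n : ℝ) ^ (2 / 3 : ℝ) by linarith)
      linarith
    refine not_two_pow_le hn (hgrowth _ hK) hnK hd2
      (two_pow_le_of_forall_path_length_lt (by norm_num) (by norm_num) hE (by omega) ?_ hKn S ?_ ?_)
    · exact Nat.ceil_pos.2 (by linarith)
    · refine hS.trans ?_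
      have h1 : (n : ℝ) ≤ 8 * κ n * 2 ^ κ n := by exact_mod_cast hnK
      calc _ ≤ (1 / 1400 : ℝ) ^ 2 / 8 * (8 * κ n * 2 ^ κ n) :=
            mul_le_mul (min_le_left _ _) h1 (by positivity) (by positivity)
        _ = _ := by ring
    · intro p hp hpS
      have h1 : (p.length : ℝ) ≤ d := (hcon p hp hpS).le.trans (Nat.le_ceil _)
      exact_mod_cast h1

end STRobustness

open STRobustness in
theorem mainTheorem5 :
    (∃ (c : ℝ) (δ : ℕ) (H : ∀ n, Digraph (Fin n)), 0 < c ∧ IsDepthRobustFamily c δ H) ∧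
    (∃ (a δ : ℕ) (A : ∀ n, IODigraph n), IsSuperconcentratorFamily a δ A) ∧
    ∀ c : ℝ, 0 < c → ∃ (c' : ℝ) (τ₀ : ℕ), 0 < c' ∧ ∀ τ : ℕ, τ₀ ≤ τ →
      ∀ (δH a δSC : ℕ) (H : ∀ n, Digraph (Fin n)) (A B : ∀ n, IODigraph n),
        IsDepthRobustFamily c δH H →
        IsSuperconcentratorFamily a δSC A →
        IsSuperconcentratorFamily a δSC B →
        (∀ n : ℕ, 1 ≤ n → ∀ x : Samples n τ,
          IsDAG (sandwich (H n) (A n) (B n) x).graph ∧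
          IndegreeLE (sandwich (H n) (A n) (B n) x).graph (δH + δSC + τ + 1) ∧
          Fintype.card (sandwich (H n) (A n) (B n) x).V ≤ (2 * a + 3) * n) ∧
        ∀ᶠ n : ℕ in Filter.atTop,
          1 - (1 / 2 : ℝ) ^ n ≤
            (ProbabilityTheory.uniformOn (Set.univ : Set (Samples n τ))).real
              {x | ∀ S : Finset (sandwich (H n) (A n) (B n) x).V, (S.card : ℝ) ≤ c' * n / 2 →
                STRobust (sandwich (H n) (A n) (B n) x) S.card (n - S.card)} := by
  refine ⟨exists_isDepthRobustFamily, exists_isSuperconcentratorFamily, fun c hc => ?_⟩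
  obtain ⟨c', τ₀, hc', hrob⟩ := sandwich_sTRobust c hc
  refine ⟨c', τ₀, hc', fun τ hτ δH a δSC H A B hH hA hB => ⟨fun n hn x => ⟨?_, ?_, ?_⟩,
    hrob τ hτ δH a δSC H A B hH hA hB⟩⟩
  · exact isDAG_sandwich (hH n hn).1 (hA n hn).1.1 (hB n hn).1.1 x
  · exact indegreeLE_sandwich (hH n hn).2.1 (hA n hn).2.2 (hB n hn).2.2 x
  · rw [card_sandwich]
    calc _ ≤ a * n + (3 * n + a * n) :=
          Nat.add_le_add (hA n hn).2.1 (Nat.add_le_add_left (hB n hn).2.1 _)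
      _ = _ := by ring
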